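/- Let $B_n$ be the Artin braid group with standard generators $\sigma_1,\dots,\sigma_{n-1}$, let $\sigma\colon B_n\to S_n$ be the homomorphism with $\sigma(\sigma_i)=(i\ \,i+1)$, and let $P_n=\ker\sigma$ be the pure braid group. Let $B_n$ act on $\mathbb Z^n$ by permuting coordinates through $\sigma$. The framed braid group is $FB_n=\mathbb Z^n\rtimes_\sigma B_n$, and the pure framed braid group $FP_n\le FB_n$ is the preimage of $P_n$ under the projection $FB_n\to B_n$. Let $t_1,\dots,t_n\in FB_n$ be the standard basis of $\mathbb Z^n$, put $\theta=t_1t_2\cdots t_n$, and let $$\Delta_n=(\sigma_1\sigma_2\cdots\sigma_{n-1})(\sigma_1\sigma_2\cdots\sigma_{n-2})\cdots(\sigma_1\sigma_2)\,\sigma_1\in B_n$$ be the half twist (so $\Delta_n^2$ is the full twist). Let $n\ge 3$. Then, with internal direct products of subgroups of $FB_n$ in (1) and (2): 1. $Z(FP_n)=\mathbb Z^n\times\langle\Delta_n^2\rangle\cong\mathbb Z^{n+1}$. 2. $Z(FB_n)=\langle\theta\rangle\times\langle\Delta_n^2\rangle\cong\mathbb Z\times\mathbb Z$. 3. For $n=3$,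 $FB_3/Z(FB_3)\cong\mathbb Z^2\rtimes PSL_2(\mathbb Z)$. More precisely, there are isomorphisms $d\colon\mathbb Z^3/\mathbb Z(1,1,1)\to\mathbb Z^2$ and $e\colon B_3/Z(B_3)\to PSL_2(\mathbb Z)$ and an action of $PSL_2(\mathbb Z)$ on $\mathbb Z^2$ such that $(h,g)\mapsto(d[h],e[g])$ induces an isomorphism $FB_3/Z(FB_3)\to\mathbb Z^2\rtimes PSL_2(\mathbb Z)$; thus $PSL_2(\mathbb Z)$ acts on $\mathbb Z^2$ by the action induced by the permutation action of $B_3$ on $\mathbb Z^3$. 4. $(FB_n)^{ab}\cong\mathbb Z\times\mathbb Z$. -/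

import Mathlib

/-- The defining relators of Artin's presentation of the braid group on `n` strands.  The generator
`i : Fin (n - 1)` is the crossing of the strands `i` and `i + 1` (strands are numbered from `0`). -/
inductive BraidRel (n : ℕ) : FreeGroup (Fin (n - 1)) → Prop
  | comm (i j : Fin (n - 1)) (h : (i : ℕ) + 2 ≤ j) :
      BraidRel n (FreeGroup.of i * FreeGroup.of j * (FreeGroup.of j * FreeGroup.of i)⁻¹)
  | braid (i j : Fin (n - 1)) (h : (i : ℕ) + 1 = j) :
      BraidRel n (FreeGroup.of i * FreeGroup.of j * FreeGroup.of i *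
        (FreeGroup.of j * FreeGroup.of i * FreeGroup.of j)⁻¹)

/-- The Artin braid group `B_n`. -/
abbrev BraidGroup (n : ℕ) : Type := PresentedGroup {r | BraidRel n r}

namespace BraidGroup

/-- The standard Artin generators of `B_n`. -/
def gen {n : ℕ} (i : Fin (n - 1)) : BraidGroup n := PresentedGroup.of i

/-- The transposition of the positions `i` and `i + 1`. -/
def adjSwap {n : ℕ} (i : Fin (n - 1)) : Equiv.Perm (Fin n) :=
  Equiv.swap ⟨i, by omega⟩ ⟨i + 1, by omega⟩

theorem lift_adjSwap_eq_one {n : ℕ} :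
    ∀ r ∈ {r | BraidRel n r}, FreeGroup.lift (adjSwap (n := n)) r = 1 := by
  rintro r (⟨i, j, h⟩ | ⟨i, j, h⟩)
  · simp only [map_mul, map_inv, FreeGroup.lift_apply_of]
    rw [mul_inv_eq_one]
    ext x
    simp only [adjSwap, Equiv.Perm.mul_apply, Equiv.swap_apply_def, Fin.ext_iff]
    grind
  · simp only [map_mul, map_inv, FreeGroup.lift_apply_of]
    rw [mul_inv_eq_one]
    ext x
    simp only [adjSwap, Equiv.Perm.mul_apply, Equiv.swap_apply_def, Fin.ext_iff]
    grind

/-- The canonical homomorphism `σ : B_n → S_n`, sending the `i`-th generator to `(i, i + 1)`. -/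
def toPerm (n : ℕ) : BraidGroup n →* Equiv.Perm (Fin n) :=
  PresentedGroup.toGroup lift_adjSwap_eq_one

/-- The product `σ_1 σ_2 ⋯ σ_k` of the first `k` generators. -/
def genProd (n k : ℕ) : BraidGroup n :=
  (((List.finRange (n - 1)).take k).map gen).prod

/-- The element `Δ_n = (σ_1 ⋯ σ_{n-1}) (σ_1 ⋯ σ_{n-2}) ⋯ (σ_1 σ_2) σ_1`. -/
def halfTwist (n : ℕ) : BraidGroup n :=
  ((List.range (n - 1)).reverse.map fun k => genProd n (k + 1)).prod

end BraidGroup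

/-- The permutational wreath pullback `H^n ⋊_σ G`: here `g` acts on `h : H^n` by
`(g • h) i = h ((σ g)⁻¹ i)`. -/
abbrev WreathPullback (H : Type*) [Group H] {G : Type*} [Group G] {n : ℕ}
    (σ : G →* Equiv.Perm (Fin n)) : Type _ :=
  (Fin n → H) ⋊[(mulAutArrow (G := Equiv.Perm (Fin n)) (A := Fin n) (M := H)).comp σ] G

/-- The framed braid group `FB_n = ℤ^n ⋊_σ B_n`. -/
abbrev FramedBraidGroup (n : ℕ) : Type :=
  WreathPullback (Multiplicative ℤ) (BraidGroup.toPerm n)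

namespace FramedBraidGroup

/-- The inclusion of `ℤ^n` (written multiplicatively) in `FB_n`. -/
def framing (n : ℕ) : (Fin n → Multiplicative ℤ) →* FramedBraidGroup n :=
  SemidirectProduct.inl

/-- The inclusion of `B_n` in `FB_n`. -/
def ofBraid (n : ℕ) : BraidGroup n →* FramedBraidGroup n :=
  SemidirectProduct.inr

/-- The framing generator `t_i`. -/
def t {n : ℕ} (i : Fin n) : FramedBraidGroup n :=
  framing n (Pi.mulSingle i (Multiplicative.ofAdd 1))

/-- The element `θ = t_1 t_2 ⋯ t_n`. -/
def theta (n : ℕ) : FramedBraidGroup n := (List.ofFn (t (n := n))).prod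

/-- The pure framed braid group `FP_n`: the preimage in `FB_n` of the pure braid group
`P_n = ker σ`. -/
def pure (n : ℕ) : Subgroup (FramedBraidGroup n) :=
  (BraidGroup.toPerm n).ker.comap SemidirectProduct.rightHom

end FramedBraidGroup

/-- The subgroup `K` is the internal direct product of its subgroups `A` and `B`. -/
structure IsInternalDirectProduct {G : Type*} [Group G] (K A B : Subgroup G) : Prop where
  sup_eq : A ⊔ B = K
  disjoint : Disjoint A B
  commute : ∀ a ∈ A, ∀ b ∈ B, Commute a b

/-- The diagonal copy of `ℤ` in `ℤ^n` (written multiplicatively). -/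
def diagonalSubgroup (n : ℕ) : Subgroup (Fin n → Multiplicative ℤ) :=
  (Pi.constMonoidHom (Fin n) (Multiplicative ℤ)).range

/-! An element `(h, g)` of `FB_n` commutes with `ℤ^n` exactly when `g` is pure, and with `B_n`
exactly when `h` is diagonal and `g` is central in `B_n`. Since `FP_n` is the direct product of
`ℤ^n` and `P_n`, both centres come down to one fact: a pure braid commuting with all pure braids is
a power of `Δ_n^2` (`mem_zpowers_halfTwist_sq`).

That fact is proved by induction on `n`, forgetting the last strand. Inside `B_{n+1}` the stabilizer
of the last strand is a free group extended by `B_n`, with `B_n` acting through Artin automorphisms.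
Only an injection of `P_{n+1}` into `StrandGroup n` is needed. It is built algebraically: `B_{n+1}`
acts on pairs (position, element of `StrandGroup n`) as it should act on cosets of the stabilizer,
and `strandLabel` reads off the second coordinate. The map `embed` back to `B_{n+1}` is a left
inverse (`embed_strandLabel`). For a central pure braid, the `B_n`-part of the label is a power of
`Δ_n^2` by induction. Dividing by the same power of `Δ_{n+1}^2` leaves an element of a free group
commuting with two distinct free generators, hence trivial.

For `n = 3`, the map `B_3 → SL_2(ℤ)` is onto, and a normal form modelled on `PSL_2(ℤ) = ℤ/2 * ℤ/3`
shows that the kernel to `PSL_2(ℤ)` is generated by `Δ^2` (`mem_zpowers_of_toSL`). As `Δ^2` is pure,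
the action on framings descends to the quotients. The abelianization is detected by total framing
and exponent sum. -/

/-- A sequence of elements satisfying the relations of the standard generators of the braid group on
`n` strands, numbered from `0`. -/
structure IsBraidSeq {G : Type*} [Group G] (n : ℕ) (f : ℕ → G) : Prop where
  comm : ∀ i j, i + 2 ≤ j → j + 1 < n → Commute (f i) (f j)
  braid : ∀ i, i + 2 < n → f i * f (i + 1) * f i = f (i + 1) * f i * f (i + 1)

/-! ### Universal property and induction for braid groups -/

namespace BraidGroup

variable {G : Type*} [Group G]

/-- The standard generators of `B_n`, indexed by `ℕ`; the value is `1` out of range. -/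
def natGen (n i : ℕ) : BraidGroup n := if h : i < n - 1 then gen ⟨i, h⟩ else 1

theorem natGen_of_lt {n i : ℕ} (h : i < n - 1) : natGen n i = gen ⟨i, h⟩ := dif_pos h

theorem isBraidSeq_natGen (n : ℕ) : IsBraidSeq n (natGen n) where
  comm i j h hj := by
    rw [natGen_of_lt (show i < n - 1 by omega), natGen_of_lt (show j < n - 1 by omega)]
    have := PresentedGroup.one_of_mem (rels := {r | BraidRel n r})
      (BraidRel.comm ⟨i, by omega⟩ ⟨j, by omega⟩ h)
    rwa [map_mul, map_inv, mul_inv_eq_one, map_mul, map_mul] at this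
  braid i h := by
    rw [natGen_of_lt (show i < n - 1 by omega), natGen_of_lt (show i + 1 < n - 1 by omega)]
    have := PresentedGroup.one_of_mem (rels := {r | BraidRel n r})
      (BraidRel.braid ⟨i, by omega⟩ ⟨i + 1, by omega⟩ rfl)
    rwa [map_mul, map_inv, mul_inv_eq_one, map_mul, map_mul, map_mul, map_mul] at this

theorem lift_eq_one_of_isBraidSeq {n : ℕ} {f : ℕ → G} (hf : IsBraidSeq n f) :
    ∀ r ∈ {r | BraidRel n r}, FreeGroup.lift (fun i : Fin (n - 1) => f i) r = 1 := by
  rintro r (⟨i, j, h⟩ | ⟨i, j, h⟩)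
  · simp only [map_mul, map_inv, FreeGroup.lift_apply_of, mul_inv_eq_one]
    exact hf.comm i j h (by omega)
  · simp only [map_mul, map_inv, FreeGroup.lift_apply_of, mul_inv_eq_one, ← h]
    exact hf.braid i (by omega)

/-- The homomorphism out of `B_n` determined by a sequence satisfying the braid relations. -/
def lift {n : ℕ} (f : ℕ → G) (hf : IsBraidSeq n f) : BraidGroup n →* G :=
  PresentedGroup.toGroup (lift_eq_one_of_isBraidSeq hf)

theorem lift_natGen {n : ℕ} {f : ℕ → G} (hf : IsBraidSeq n f) {i : ℕ} (hi : i + 1 < n) :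
    lift f hf (natGen n i) = f i := by
  rw [natGen_of_lt (show i < n - 1 by omega)]
  exact PresentedGroup.toGroup.of _

theorem toPerm_natGen {n i : ℕ} (hi : i + 1 < n) :
    toPerm n (natGen n i) = Equiv.swap ⟨i, by omega⟩ ⟨i + 1, hi⟩ := by
  rw [natGen_of_lt (show i < n - 1 by omega)]
  exact PresentedGroup.toGroup.of _

@[elab_as_elim]
theorem induction {n : ℕ} {p : BraidGroup n → Prop} (x : BraidGroup n)
    (gen : ∀ i, i + 1 < n → p (natGen n i)) (one : p 1)
    (mul : ∀ x y, p x → p y → p (x * y)) (inv : ∀ x, p x → p x⁻¹) : p x := by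
  let H : Subgroup (BraidGroup n) :=
    { carrier := {x | p x}, mul_mem' := mul _ _, one_mem' := one, inv_mem' := inv _ }
  refine PresentedGroup.generated_by _ H (fun j => ?_) x
  have := gen j (by omega)
  rwa [natGen_of_lt j.2] at this

theorem hom_ext {n : ℕ} {φ ψ : BraidGroup n →* G}
    (h : ∀ i, i + 1 < n → φ (natGen n i) = ψ (natGen n i)) : φ = ψ := by
  refine MonoidHom.ext fun x => ?_
  induction x using BraidGroup.induction with
  | gen i hi => exact h i hi
  | one => simp
  | mul x y hx hy => simp [hx, hy]
  | inv x hx => simp [hx]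

theorem mem_center_of_commute_natGen {n : ℕ} {z : BraidGroup n}
    (h : ∀ i, i + 1 < n → Commute z (natGen n i)) (x : BraidGroup n) : Commute z x := by
  induction x using BraidGroup.induction with
  | gen i hi => exact h i hi
  | one => exact Commute.one_right z
  | mul x y hx hy => exact hx.mul_right hy
  | inv x hx => exact hx.inv_right

end BraidGroup

/-! ### The half twist and centrality of its square -/

section Run

variable {G : Type*} [Group G]

/-- The product `f 0 * f 1 * ⋯ * f (k - 1)`. -/
def run (f : ℕ → G) : ℕ → G
  | 0 => 1
  | k + 1 => run f k * f k

/-- The product `f (k - 1) * ⋯ * f 1 * f 0`. -/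
def revRun (f : ℕ → G) : ℕ → G
  | 0 => 1
  | k + 1 => f k * revRun f k

/-- The half twist on the first `k` strands. -/
def twist (f : ℕ → G) : ℕ → G
  | 0 => 1
  | k + 1 => run f k * twist f k

theorem run_eq_prod (f : ℕ → G) (k : ℕ) : run f k = ((List.range k).map f).prod := by
  induction k with
  | zero => rfl
  | succ k ih => simp [run, List.range_succ, ih]

theorem map_run {H : Type*} [Group H] (φ : G →* H) (f : ℕ → G) (k : ℕ) :
    φ (run f k) = run (fun i => φ (f i)) k := by
  induction k with
  | zero => simp [run]
  | succ k ih => simp [run, ih]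

theorem map_twist {H : Type*} [Group H] (φ : G →* H) (f : ℕ → G) (k : ℕ) :
    φ (twist f k) = twist (fun i => φ (f i)) k := by
  induction k with
  | zero => simp [twist]
  | succ k ih => simp [twist, map_run, ih]

theorem run_congr {f g : ℕ → G} {k : ℕ} (h : ∀ i, i < k → f i = g i) : run f k = run g k := by
  induction k with
  | zero => rfl
  | succ k ih => rw [run, run, ih fun i hi => h i (by omega), h k (by omega)]

theorem twist_congr {f g : ℕ → G} {k : ℕ} (h : ∀ i, i + 1 < k → f i = g i) :
    twist f k = twist g k := by
  induction k with
  | zero => rfl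
  | succ k ih =>
    rw [twist, twist, ih fun i hi => h i (by omega), run_congr fun i hi => h i (by omega)]

theorem BraidGroup.halfTwist_eq_twist (n : ℕ) :
    BraidGroup.halfTwist n = twist (BraidGroup.natGen n) n := by
  have hrun : ∀ k, k ≤ n - 1 → BraidGroup.genProd n k = run (BraidGroup.natGen n) k := by
    intro k hk
    have : (List.finRange (n - 1)).map BraidGroup.gen =
        (List.range (n - 1)).map (BraidGroup.natGen n) := by
      rw [← List.map_coe_finRange_eq_range, List.map_map]
      exact List.map_congr_left fun i _ => (BraidGroup.natGen_of_lt i.2).symm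
    rw [BraidGroup.genProd, List.map_take, this, ← List.map_take, List.take_range,
      min_eq_left hk, run_eq_prod]
  have key : ∀ m, m ≤ n - 1 → ((List.range m).reverse.map fun k =>
      BraidGroup.genProd n (k + 1)).prod = twist (BraidGroup.natGen n) (m + 1) := by
    intro m
    induction m with
    | zero => intro _; simp [twist, run]
    | succ m ih =>
      intro hm
      rw [List.range_succ, List.reverse_append, List.map_append, List.prod_append,
        ih (by omega)]
      change _ = run (BraidGroup.natGen n) (m + 1) * _
      simp [← hrun _ hm]
  rcases n with - | n
  · rfl
  · exact key n le_rfl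

namespace IsBraidSeq

variable {n : ℕ} {f : ℕ → G} (hf : IsBraidSeq n f)
include hf

theorem commute_run {j k : ℕ} (hk : k < j) (hj : j + 1 < n) : Commute (f j) (run f k) := by
  induction k with
  | zero => exact Commute.one_right _
  | succ k ih => exact (ih (by omega)).mul_right (hf.comm k j (by omega) hj).symm

theorem commute_twist {j k : ℕ} (hk : k ≤ j) (hj : j + 1 < n) : Commute (f j) (twist f k) := by
  induction k with
  | zero => exact Commute.one_right _
  | succ k ih => exact (hf.commute_run (by omega) hj).mul_right (ih (by omega))

theorem semiconjBy_braid {i : ℕ} (h : i + 2 < n) : SemiconjBy (f i * f (i + 1)) (f i) (f (i + 1)) := by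
  rw [SemiconjBy, hf.braid i h, mul_assoc]

theorem semiconjBy_run {i k : ℕ} (hi : i + 1 < k) (hk : k < n) :
    SemiconjBy (run f k) (f i) (f (i + 1)) := by
  induction k with
  | zero => omega
  | succ k ih =>
    rcases Nat.lt_or_ge (i + 1) k with h | h
    · exact (ih h (by omega)).mul_left (hf.comm i k (by omega) (by omega)).symm
    · obtain rfl : k = i + 1 := by omega
      rw [run, run, mul_assoc]
      exact SemiconjBy.mul_left (hf.commute_run (by omega) (by omega)).symm
        (hf.semiconjBy_braid (by omega))

/-- Conjugation by a run shifts indices up by one, so the letters of the second run pass to the left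
of the first, leaving `f 0` in front. -/
theorem run_mul_run {k : ℕ} (hk : k + 1 < n) :
    run f (k + 1) * run f (k + 1) = f 0 * run f (k + 1) * run f k := by
  have h2 : ∀ m, m ≤ k → f 0 * run f (k + 1) * run f m = run f (m + 1) * run f (k + 1) := by
    intro m hm
    induction m with
    | zero => simp [run]
    | succ m ih =>
      rw [run.eq_def f (m + 1), ← mul_assoc, ih (by omega), mul_assoc,
        (hf.semiconjBy_run (show m + 1 < k + 1 by omega) hk).eq, ← mul_assoc]
      rfl
  exact (h2 k le_rfl).symm

/-- The half twist reverses the order of the strands. A run shifts indices up by one, which turns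
the reversal on `k` strands into the reversal on `k + 1` strands; the index `0` is not reached by a
shift and comes from `run_mul_run`. -/
theorem semiconjBy_twist {i j k : ℕ} (h : i + j + 2 = k) (hk : k ≤ n) :
    SemiconjBy (twist f k) (f i) (f j) := by
  induction k generalizing i j with
  | zero => omega
  | succ k ih =>
    rcases j with - | j
    · obtain rfl : k = i + 1 := by omega
      rw [SemiconjBy, twist, twist]
      calc run f (i + 1) * (run f i * twist f i) * f i
          = run f (i + 1) * run f i * (twist f i * f i) := by simp only [mul_assoc]
        _ = run f (i + 1) * (run f i * f i) * twist f i := by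
            rw [← (hf.commute_twist le_rfl (by omega)).eq]; simp only [mul_assoc]
        _ = f 0 * (run f (i + 1) * (run f i * twist f i)) := by
            rw [← run, hf.run_mul_run (by omega)]; simp only [mul_assoc]
    · exact (hf.semiconjBy_run (by omega) (by omega)).mul_left (ih (by omega) (by omega))

theorem twist_succ {k : ℕ} (hk : k < n) : twist f (k + 1) = twist f k * revRun f k := by
  induction k with
  | zero => simp [twist, run, revRun]
  | succ k ih =>
    calc twist f (k + 2) = run f k * f k * (twist f k * revRun f k) := by
          rw [twist, ih (by omega), run]
      _ = run f k * (f k * twist f k) * revRun f k := by simp only [mul_assoc]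
      _ = twist f (k + 1) * revRun f (k + 1) := by
          rw [(hf.commute_twist le_rfl (by omega)).eq, twist, revRun]; simp only [mul_assoc]

/-- The two factorizations of the half twist, with the run on the left or the reversed run on the
right, isolate the last strand. This feeds the induction on the number of strands. -/
theorem twist_sq_succ {k : ℕ} (hk : k < n) :
    twist f (k + 1) ^ 2 = twist f k * (revRun f k * run f k) * twist f k := by
  rw [pow_two]
  nth_rw 1 [hf.twist_succ hk]
  rw [twist]
  simp only [mul_assoc]

theorem commute_twist_sq {i : ℕ} (hi : i + 1 < n) : Commute (twist f n ^ 2) (f i) := by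
  rw [pow_two]
  exact SemiconjBy.mul_left (hf.semiconjBy_twist (i := n - 2 - i) (by omega) le_rfl)
    (hf.semiconjBy_twist (by omega) le_rfl)

end IsBraidSeq

end Run

theorem BraidGroup.commute_halfTwist_sq (n : ℕ) (x : BraidGroup n) :
    Commute (BraidGroup.halfTwist n ^ 2) x := by
  rw [BraidGroup.halfTwist_eq_twist]
  exact BraidGroup.mem_center_of_commute_natGen
    (fun i hi => (BraidGroup.isBraidSeq_natGen n).commute_twist_sq hi) x

/-! ### Artin's action on the free group -/

namespace FreeGroup

/-- The automorphism of the free group through which a generator of the braid group acts. -/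
def artinGen (j : ℕ) : MulAut (FreeGroup ℕ) :=
  MonoidHom.toMulEquiv
    (FreeGroup.lift fun k => if k = j + 1 then of j else
      if k = j then (of j)⁻¹ * of (j + 1) * of j else of k)
    (FreeGroup.lift fun k => if k = j then of (j + 1) else
      if k = j + 1 then of (j + 1) * of j * (of (j + 1))⁻¹ else of k)
    (by
      ext k
      by_cases h : k = j + 1
      · simp [h]
      · by_cases h' : k = j
        · subst h'; simp [mul_assoc]
        · simp [h, h'])
    (by
      ext k
      by_cases h : k = j
      · simp [h]
      · by_cases h' : k = j + 1
        · subst h'; simp [mul_assoc]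
        · simp [h, h'])

theorem artinGen_of (j k : ℕ) : artinGen j (of k) = if k = j + 1 then of j else
    if k = j then (of j)⁻¹ * of (j + 1) * of j else of k := by
  simp [artinGen]

theorem mulAut_ext {α : Type*} {φ ψ : MulAut (FreeGroup α)} (h : ∀ k, φ (of k) = ψ (of k)) :
    φ = ψ := by
  have : (φ : FreeGroup α ≃* FreeGroup α).toMonoidHom =
      (ψ : FreeGroup α ≃* FreeGroup α).toMonoidHom := FreeGroup.ext_hom _ _ h
  exact MulEquiv.ext fun x => DFunLike.congr_fun this x

theorem isBraidSeq_artinGen (n : ℕ) : IsBraidSeq n artinGen where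
  comm i j h _ := by
    refine mulAut_ext fun k => ?_
    simp only [MulAut.mul_apply, artinGen_of]
    by_cases h1 : k = i + 1
    · have : i ≠ j := by omega
      have : i ≠ j + 1 := by omega
      have : i + 1 ≠ j := by omega
      have : i + 1 ≠ j + 1 := by omega
      simp_all [artinGen_of]
    by_cases h2 : k = i
    · have : i ≠ j := by omega
      have : i ≠ j + 1 := by omega
      have : i + 1 ≠ j := by omega
      have : i + 1 ≠ j + 1 := by omega
      simp_all [artinGen_of]
    by_cases h3 : k = j + 1
    · have : j ≠ i := by omega
      have : j ≠ i + 1 := by omega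
      have : j + 1 ≠ i := by omega
      simp_all [artinGen_of]
    by_cases h4 : k = j
    · have : j ≠ i := by omega
      have : j ≠ i + 1 := by omega
      have : j + 1 ≠ i := by omega
      simp_all [artinGen_of]
    simp_all [artinGen_of]
  braid i _ := by
    refine mulAut_ext fun k => ?_
    simp only [MulAut.mul_apply, artinGen_of]
    have e1 : i ≠ i + 1 + 1 := by omega
    have e2 : i + 1 + 1 ≠ i := by omega
    by_cases h1 : k = i
    · simp [h1, e1, e2, artinGen_of, mul_assoc]
    by_cases h2 : k = i + 1
    · simp [h2, e1, e2, artinGen_of, mul_assoc]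
    by_cases h3 : k = i + 1 + 1
    · simp [h3, e1, e2, artinGen_of]
    simp [h1, h2, h3, artinGen_of]

/-- If `x` commutes with a generator, its reduced word must begin with that generator or its
inverse; two different generators cannot both do so. -/
theorem eq_one_of_commute_of_zero_of_one {x : FreeGroup ℕ} (h0 : Commute x (of 0))
    (h1 : Commute x (of 1)) : x = 1 := by
  by_contra hx
  have key : ∀ a : ℕ, Commute x (of a) → ∀ c L, x.toWord = c :: L → c.1 = a := by
    intro a ha c L hc
    by_contra hne
    have hred : IsReduced (c :: L) := hc ▸ isReduced_toWord
    have e1 : (of a * x).toWord = (a, true) :: c :: L := by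
      rw [toWord_mul, toWord_of, hc]
      refine IsReduced.reduce_eq ?_
      simp only [List.cons_append, List.nil_append]
      rw [isReduced_cons_cons]
      exact ⟨fun h => absurd h.symm hne, hred⟩
    -- The same element is `x * of a`, whose reduced word is a sublist of a word of exactly the
    -- length in `e1`; so the two words coincide, and comparing first letters gives the
    -- contradiction.
    have e2 : (of a * x).toWord.Sublist (c :: L ++ [(a, true)]) := by
      rw [← ha.eq]
      simpa [hc] using toWord_mul_sublist x (of a)
    rw [e1] at e2
    have := e2.eq_of_length (by simp)
    simp only [List.cons_append, List.cons.injEq] at this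
    exact hne (by rw [← this.1])
  rcases hw : x.toWord with - | ⟨c, L⟩
  · exact hx (toWord_eq_nil_iff.1 hw)
  · have := key 0 h0 c L hw
    have := key 1 h1 c L hw
    omega

end FreeGroup

/-- The semidirect product of a free group with the braid group on `n` strands, in which the
stabilizer of a strand in the braid group on `n + 1` strands embeds. -/
abbrev StrandGroup (n : ℕ) : Type :=
  FreeGroup ℕ ⋊[BraidGroup.lift FreeGroup.artinGen (FreeGroup.isBraidSeq_artinGen n)] BraidGroup n

/-! ### Relations between loops and crossings -/

namespace StrandGroup

open SemidirectProduct BraidGroup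
open FreeGroup (of artinGen artinGen_of isBraidSeq_artinGen)

/-- The free generators of the kernel of forgetting a strand. -/
def loop (n k : ℕ) : StrandGroup n := inl (of k)

/-- The braid generators. -/
def cross (n k : ℕ) : StrandGroup n := inr (natGen n k)

theorem isBraidSeq_cross (n : ℕ) : IsBraidSeq n (cross n) where
  comm i j h hj := ((isBraidSeq_natGen n).comm i j h hj).map inr
  braid i h := by
    have := congrArg (inr (φ := BraidGroup.lift artinGen (isBraidSeq_artinGen n)))
      ((isBraidSeq_natGen n).braid i h)
    simpa only [cross, map_mul] using this

theorem cross_mul_loop {n j : ℕ} (hj : j + 1 < n) (k : ℕ) :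
    cross n j * loop n k = inl (artinGen j (of k)) * cross n j := by
  have := inl_aut (φ := BraidGroup.lift artinGen (isBraidSeq_artinGen n)) (natGen n j) (of k)
  rw [lift_natGen _ hj] at this
  rw [this, cross, loop, map_inv, inv_mul_cancel_right]

theorem commute_cross_loop {n j k : ℕ} (hj : j + 1 < n) (h : k ≠ j) (h' : k ≠ j + 1) :
    Commute (cross n j) (loop n k) := by
  rw [Commute, SemiconjBy, cross_mul_loop hj, artinGen_of, if_neg h', if_neg h, loop]

theorem cross_mul_loop_succ {n j : ℕ} (hj : j + 1 < n) :
    cross n j * loop n (j + 1) = loop n j * cross n j := by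
  rw [cross_mul_loop hj, artinGen_of, if_pos rfl, loop]

/-- The Artin automorphism fixes this product of neighbouring generators. This form avoids the
conjugate that appears when a crossing passes a single loop. -/
theorem cross_mul_loop_succ_mul_loop {n j : ℕ} (hj : j + 1 < n) :
    cross n j * (loop n (j + 1) * loop n j) = loop n (j + 1) * loop n j * cross n j := by
  rw [← mul_assoc, cross_mul_loop_succ hj, mul_assoc, cross_mul_loop hj, artinGen_of, if_neg (by omega),
    if_pos rfl, loop, loop, ← mul_assoc, ← map_mul, ← map_mul]
  simp [mul_assoc]

end StrandGroup

/-! ### The braid group acting on cosets of a strand stabilizer -/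

namespace StrandGroup

open SemidirectProduct BraidGroup
open FreeGroup (of artinGen artinGen_of isBraidSeq_artinGen)

/-- The cocycle describing how the generator `j` moves the coset of position `k`. -/
def label (n j k : ℕ) : StrandGroup n :=
  -- The values solve `σ_j * rep k = rep k' * label`, where `k'` is the image of `k` under the swap;
  -- see `natGen_mul_rep`. Positions beyond `n` are inert.
  if n < k then 1 else if j + 1 < k then cross n j else if j + 1 = k then 1 else
    if j = k then loop n k else cross n (j - 1)

/-- The action of a generator of the braid group on `n + 1` strands on the cosets of the stabilizer
of the last strand. -/
def strandPerm (n j : ℕ) : Equiv.Perm (ℕ × StrandGroup n) :=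
  Equiv.prodShear (Equiv.swap j (j + 1)) fun k => Equiv.mulLeft (label n j k)

theorem strandPerm_apply (n j k : ℕ) (d : StrandGroup n) :
    strandPerm n j (k, d) = (Equiv.swap j (j + 1) k, label n j k * d) := rfl

theorem strandPerm_self {n j : ℕ} (hj : j ≤ n) (d : StrandGroup n) :
    strandPerm n j (j, d) = (j + 1, loop n j * d) := by
  rw [strandPerm_apply, Equiv.swap_apply_left, label, if_neg (by omega), if_neg (by omega),
    if_neg (by omega), if_pos rfl]

theorem strandPerm_succ (n j : ℕ) (d : StrandGroup n) :
    strandPerm n j (j + 1, d) = (j, d) := by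
  rw [strandPerm_apply, Equiv.swap_apply_right, label]
  simp

theorem strandPerm_of_lt {n j k : ℕ} (h : j + 1 < k) (hk : k ≤ n) (d : StrandGroup n) :
    strandPerm n j (k, d) = (k, cross n j * d) := by
  rw [strandPerm_apply, Equiv.swap_apply_of_ne_of_ne (by omega) (by omega), label,
    if_neg (by omega), if_pos h]

theorem strandPerm_of_gt {n j k : ℕ} (h : k ≤ j) (hk : k ≤ n) (d : StrandGroup n) :
    strandPerm n (j + 1) (k, d) = (k, cross n j * d) := by
  rw [strandPerm_apply, Equiv.swap_apply_of_ne_of_ne (by omega) (by omega), label,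
    if_neg (by omega), if_neg (by omega), if_neg (by omega), if_neg (by omega), Nat.add_sub_cancel]

theorem strandPerm_of_out {n j k : ℕ} (hj : j < n) (hk : n < k) (d : StrandGroup n) :
    strandPerm n j (k, d) = (k, d) := by
  rw [strandPerm_apply, Equiv.swap_apply_of_ne_of_ne (by omega) (by omega), label,
    if_pos hk, one_mul]

/-- For each place of `k` relative to the crossings, the relation becomes trivial or a relation in
`StrandGroup n`. The braid relation at `k = i + 1` and `k = i` is exactly `cross_mul_loop_succ` and
`cross_mul_loop_succ_mul_loop`, which is what dictates the Artin automorphisms. -/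
theorem isBraidSeq_strandPerm (n : ℕ) : IsBraidSeq (n + 1) (strandPerm n) where
  comm i j h hj := by
    refine Equiv.ext fun ⟨k, d⟩ => ?_
    obtain ⟨j, rfl⟩ : ∃ l, j = l + 1 := ⟨j - 1, by omega⟩
    simp only [Equiv.Perm.mul_apply]
    rcases Nat.lt_or_ge n k with h1 | h1
    · simp only [strandPerm_of_out (show j + 1 < n by omega) h1,
        strandPerm_of_out (show i < n by omega) h1]
    rcases Nat.lt_or_ge (j + 2) k with h2 | h2
    · simp only [strandPerm_of_lt h2 h1, strandPerm_of_lt (show i + 1 < k by omega) h1, ← mul_assoc,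
        ((isBraidSeq_cross n).comm i (j + 1) h (by omega)).eq]
    rcases Nat.eq_or_lt_of_le h2 with rfl | h2
    · simp only [strandPerm_succ, strandPerm_of_lt (show i + 1 < j + 2 by omega) h1,
        strandPerm_of_lt (show i + 1 < j + 1 by omega) (show j + 1 ≤ n by omega)]
    rcases Nat.eq_or_lt_of_le (Nat.le_of_lt_succ h2) with rfl | h2
    · simp only [strandPerm_self h1, strandPerm_of_lt (show i + 1 < j + 1 + 1 by omega) (show j + 2 ≤ n by omega),
        strandPerm_of_lt (show i + 1 < j + 1 by omega) h1, ← mul_assoc,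
        (commute_cross_loop (show i + 1 < n by omega) (show j + 1 ≠ i by omega)
          (show j + 1 ≠ i + 1 by omega)).eq]
    rw [strandPerm_of_gt (show k ≤ j by omega) h1]
    rcases Nat.lt_or_ge (i + 1) k with h3 | h3
    · simp only [strandPerm_of_lt h3 h1, strandPerm_of_gt (show k ≤ j by omega) h1, ← mul_assoc,
        ((isBraidSeq_cross n).comm i j (by omega) (by omega)).eq]
    rcases Nat.eq_or_lt_of_le h3 with rfl | h3
    · simp only [strandPerm_succ, strandPerm_of_gt (show i ≤ j by omega) (show i ≤ n by omega)]
    rcases Nat.eq_or_lt_of_le (Nat.le_of_lt_succ h3) with rfl | h3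
    · simp only [strandPerm_self h1, strandPerm_of_gt (show k + 1 ≤ j by omega) (show k + 1 ≤ n by omega),
        ← mul_assoc, (commute_cross_loop (show j + 1 < n by omega) (show k ≠ j by omega)
          (show k ≠ j + 1 by omega)).eq]
    obtain ⟨i, rfl⟩ : ∃ l, i = l + 1 := ⟨i - 1, by omega⟩
    simp only [strandPerm_of_gt (show k ≤ j by omega) h1, strandPerm_of_gt (show k ≤ i by omega) h1,
      ← mul_assoc, ((isBraidSeq_cross n).comm i j (by omega) (by omega)).eq]
  braid i hi := by
    refine Equiv.ext fun ⟨k, d⟩ => ?_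
    simp only [Equiv.Perm.mul_apply]
    rcases Nat.lt_or_ge n k with h1 | h1
    · simp only [strandPerm_of_out (show i + 1 < n by omega) h1,
        strandPerm_of_out (show i < n by omega) h1]
    rcases Nat.lt_or_ge (i + 2) k with h2 | h2
    · simp only [strandPerm_of_lt h2 h1, strandPerm_of_lt (show i + 1 < k by omega) h1, ← mul_assoc,
        (isBraidSeq_cross n).braid i (by omega)]
    rcases Nat.eq_or_lt_of_le h2 with rfl | h2
    · rw [strandPerm_of_lt (by omega) h1]
      simp only [strandPerm_succ]
      rw [strandPerm_of_gt le_rfl (by omega)]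
    rcases Nat.eq_or_lt_of_le (Nat.le_of_lt_succ h2) with rfl | h2
    · rw [strandPerm_succ, strandPerm_self h1, strandPerm_of_gt le_rfl (by omega),
        strandPerm_of_lt (show i + 1 < i + 1 + 1 by omega) (by omega), strandPerm_succ,
        strandPerm_self (by omega), ← mul_assoc, ← mul_assoc, cross_mul_loop_succ (by omega)]
    rcases Nat.eq_or_lt_of_le (Nat.le_of_lt_succ h2) with rfl | h2
    · rw [strandPerm_self h1, strandPerm_self (by omega), strandPerm_of_lt (by omega) (by omega),
        strandPerm_of_gt le_rfl h1, strandPerm_self h1, strandPerm_self (by omega),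
        ← mul_assoc (loop n (k + 1)), ← mul_assoc (cross n k),
        cross_mul_loop_succ_mul_loop (by omega), mul_assoc (loop n (k + 1) * loop n k), mul_assoc]
    obtain ⟨i, rfl⟩ : ∃ l, i = l + 1 := ⟨i - 1, by omega⟩
    simp only [strandPerm_of_gt (show k ≤ i + 1 by omega) h1,
      strandPerm_of_gt (show k ≤ i by omega) h1, ← mul_assoc,
      (isBraidSeq_cross n).braid i (by omega)]

/-- The action of the braid group on `n + 1` strands on the cosets of the stabilizer of the last
strand. -/
def strandAction (n : ℕ) : BraidGroup (n + 1) →* Equiv.Perm (ℕ × StrandGroup n) :=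
  BraidGroup.lift (strandPerm n) (isBraidSeq_strandPerm n)

theorem strandAction_natGen {n j : ℕ} (hj : j < n) :
    strandAction n (natGen (n + 1) j) = strandPerm n j :=
  lift_natGen _ (by omega)

/-! ### Coset representatives, pure loops and the embedding -/

/-- The coset representative `σ_k ⋯ σ_{n-1}` of the position `k`. -/
def rep (n k : ℕ) : BraidGroup (n + 1) := (run (natGen (n + 1)) k)⁻¹ * run (natGen (n + 1)) n

theorem rep_self (n : ℕ) : rep n n = 1 := inv_mul_cancel _

theorem rep_zero (n : ℕ) : rep n 0 = run (natGen (n + 1)) n := by simp [rep, run]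

theorem natGen_mul_rep_succ (n k : ℕ) : natGen (n + 1) k * rep n (k + 1) = rep n k := by
  simp [rep, run, mul_assoc]

theorem commute_natGen_rep {n j k : ℕ} (h : j + 1 < k) (hk : k ≤ n) :
    Commute (natGen (n + 1) j) (rep n k) := by
  have hs := isBraidSeq_natGen (n + 1)
  exact (SemiconjBy.mul_left (hs.semiconjBy_run h (by omega)).inv_symm_left
    (hs.semiconjBy_run (by omega) (by omega))).symm

theorem semiconjBy_rep {n j k : ℕ} (h : k ≤ j) (hj : j + 1 < n) :
    SemiconjBy (rep n k) (natGen (n + 1) j) (natGen (n + 1) (j + 1)) := by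
  have hs := isBraidSeq_natGen (n + 1)
  refine SemiconjBy.mul_left ?_ (hs.semiconjBy_run (by omega) (by omega))
  exact (hs.commute_run (by omega) (by omega)).symm.inv_left

/-- The pure braid in which the last strand goes once around the strand `k`. -/
def pureLoop (n k : ℕ) : BraidGroup (n + 1) :=
  -- The free group has infinitely many generators, but only the first `n` stand for strands;
  -- sending the others to `1` is harmless because `embed` need not be injective.
  if k < n then (rep n (k + 1))⁻¹ * (natGen (n + 1) k * rep n k) else 1

theorem pureLoop_eq {n k : ℕ} (hk : k < n) :
    pureLoop n k = (rep n k)⁻¹ * (natGen (n + 1) k * natGen (n + 1) k) * rep n k := by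
  rw [pureLoop, if_pos hk, ← natGen_mul_rep_succ n k]
  group

theorem commute_natGen_pureLoop {n j k : ℕ} (hj : j + 1 < n) (h : k ≠ j) (h' : k ≠ j + 1) :
    Commute (natGen (n + 1) j) (pureLoop n k) := by
  have hs := isBraidSeq_natGen (n + 1)
  by_cases hk : k < n
  · rw [pureLoop_eq hk]
    rcases Nat.lt_or_ge j k with h2 | h2
    · have c := commute_natGen_rep (show j + 1 < k by omega) hk.le
      have c' := hs.comm j k (by omega) (by omega)
      exact (c.inv_right.mul_right (c'.mul_right c')).mul_right c
    · have c := semiconjBy_rep (show k ≤ j by omega) hj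
      have c' : SemiconjBy _ _ _ := hs.comm k (j + 1) (by omega) (by omega)
      exact Commute.symm (SemiconjBy.mul_left (SemiconjBy.mul_left c.inv_symm_left (c'.mul_left c')) c)
  · rw [pureLoop, if_neg hk]
    exact Commute.one_right _

end StrandGroup

namespace StrandGroup

open SemidirectProduct BraidGroup
open FreeGroup (of artinGen artinGen_of isBraidSeq_artinGen)

/-- Both loops are conjugated by the same `rep n (j + 2)`, which commutes with `σ_j`; relations
between them become identities in two adjacent generators. -/
theorem pureLoop_succ_pair {n j : ℕ} (hj : j + 1 < n) :
    pureLoop n (j + 1) = (rep n (j + 2))⁻¹ * (natGen (n + 1) (j + 1) * natGen (n + 1) (j + 1)) *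
        rep n (j + 2) ∧
      pureLoop n j = (rep n (j + 2))⁻¹ * ((natGen (n + 1) (j + 1))⁻¹ *
        (natGen (n + 1) j * natGen (n + 1) j) * natGen (n + 1) (j + 1)) * rep n (j + 2) := by
  constructor
  · rw [pureLoop, if_pos hj, ← natGen_mul_rep_succ n (j + 1)]
    group
  · rw [pureLoop, if_pos (by omega), ← natGen_mul_rep_succ n j, ← natGen_mul_rep_succ n (j + 1)]
    group

theorem natGen_mul_pureLoop_succ {n j : ℕ} (hj : j + 1 < n) :
    natGen (n + 1) j * pureLoop n (j + 1) = pureLoop n j * natGen (n + 1) j := by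
  obtain ⟨e1, e2⟩ := pureLoop_succ_pair hj
  rw [e1, e2]
  have hq : Commute (natGen (n + 1) j) (rep n (j + 2)) :=
    commute_natGen_rep (by omega) (by omega)
  have hb := (isBraidSeq_natGen (n + 1)).braid j (by omega)
  generalize natGen (n + 1) j = x at *
  generalize natGen (n + 1) (j + 1) = y at *
  have c : SemiconjBy x (y * y) (y⁻¹ * (x * x) * y) := by
    rw [SemiconjBy]
    calc x * (y * y) = y⁻¹ * ((y * x * y) * y) := by group
      _ = y⁻¹ * ((x * y * x) * y) := by rw [hb]
      _ = y⁻¹ * (x * (y * x * y)) := by group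
      _ = y⁻¹ * (x * x) * y * x := by rw [← hb]; group
  exact (SemiconjBy.mul_right (SemiconjBy.mul_right hq.inv_right c) hq).eq

theorem natGen_mul_pureLoop_succ_mul_pureLoop {n j : ℕ} (hj : j + 1 < n) :
    natGen (n + 1) j * (pureLoop n (j + 1) * pureLoop n j) =
      pureLoop n (j + 1) * pureLoop n j * natGen (n + 1) j := by
  obtain ⟨e1, e2⟩ := pureLoop_succ_pair hj
  rw [e1, e2]
  have hq : Commute (natGen (n + 1) j) (rep n (j + 2)) :=
    commute_natGen_rep (by omega) (by omega)
  have hb := (isBraidSeq_natGen (n + 1)).braid j (by omega)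
  generalize natGen (n + 1) j = x at *
  generalize natGen (n + 1) (j + 1) = y at *
  generalize rep n (j + 2) = q at *
  have c : SemiconjBy x (y * x * x * y) (y * x * x * y) := by
    rw [SemiconjBy]
    calc x * (y * x * x * y) = (x * y * x) * x * y := by group
      _ = y * x * (y * x * y) := by rw [hb]; group
      _ = y * x * x * y * x := by rw [← hb]; group
  have e : q⁻¹ * (y * y) * q * (q⁻¹ * (y⁻¹ * (x * x) * y) * q) = q⁻¹ * (y * x * x * y) * q := by
    group
  rw [e]
  exact (SemiconjBy.mul_right (SemiconjBy.mul_right hq.inv_right c) hq).eq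

/-- The inclusion of `B_n` in `B_{n+1}`. -/
def braidIncl (n : ℕ) : BraidGroup n →* BraidGroup (n + 1) :=
  BraidGroup.lift (natGen (n + 1))
    { comm := fun i j h hj => (isBraidSeq_natGen (n + 1)).comm i j h (by omega)
      braid := fun i h => (isBraidSeq_natGen (n + 1)).braid i (by omega) }

theorem braidIncl_natGen {n j : ℕ} (hj : j + 1 < n) :
    braidIncl n (natGen n j) = natGen (n + 1) j := lift_natGen _ hj

/-- Conjugation by a braid acts on the pure loops by the Artin formulas; this is the compatibility
that makes `embed` a homomorphism. -/
theorem lift_pureLoop_aut (n : ℕ) (g : BraidGroup n) : ∀ w : FreeGroup ℕ,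
    FreeGroup.lift (pureLoop n) (BraidGroup.lift artinGen (isBraidSeq_artinGen n) g w) =
      braidIncl n g * FreeGroup.lift (pureLoop n) w * (braidIncl n g)⁻¹ := by
  induction g using BraidGroup.induction with
  | gen j hj =>
    rw [lift_natGen _ hj, braidIncl_natGen hj]
    refine DFunLike.congr_fun (f := (FreeGroup.lift (pureLoop n)).comp (artinGen j).toMonoidHom)
      (g := (MulAut.conj (natGen (n + 1) j)).toMonoidHom.comp (FreeGroup.lift (pureLoop n)))
      (FreeGroup.ext_hom _ _ fun k => ?_)
    change FreeGroup.lift (pureLoop n) (artinGen j (of k)) =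
      natGen (n + 1) j * FreeGroup.lift (pureLoop n) (of k) * (natGen (n + 1) j)⁻¹
    rw [eq_mul_inv_iff_mul_eq, artinGen_of]
    split_ifs with h1 h2
    · subst h1
      simp only [FreeGroup.lift_apply_of]
      exact (natGen_mul_pureLoop_succ hj).symm
    · subst h2
      simp only [map_mul, map_inv, FreeGroup.lift_apply_of]
      have h3 := natGen_mul_pureLoop_succ_mul_pureLoop hj
      rw [← mul_assoc, natGen_mul_pureLoop_succ hj] at h3
      rw [mul_assoc, mul_assoc, inv_mul_eq_iff_eq_mul, ← mul_assoc, ← h3, mul_assoc]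
    · simp only [FreeGroup.lift_apply_of]
      exact (commute_natGen_pureLoop hj h2 h1).eq.symm
  | one => simp
  | mul x y hx hy =>
    intro w
    rw [map_mul, MulAut.mul_apply, hx, hy, map_mul]
    group
  | inv x hx =>
    intro w
    have := hx (BraidGroup.lift artinGen (isBraidSeq_artinGen n) x⁻¹ w)
    rw [← MulAut.mul_apply, ← map_mul, mul_inv_cancel, map_one, MulAut.one_apply] at this
    rw [this, map_inv (braidIncl n)]
    generalize FreeGroup.lift (pureLoop n) _ = a
    group

/-- The embedding of the stabilizer of the last strand. -/
def embed (n : ℕ) : StrandGroup n →* BraidGroup (n + 1) :=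
  SemidirectProduct.lift (FreeGroup.lift (pureLoop n)) (braidIncl n) fun g =>
    MonoidHom.ext fun w => lift_pureLoop_aut n g w

theorem embed_inl (n : ℕ) (w : FreeGroup ℕ) :
    embed n (inl w) = FreeGroup.lift (pureLoop n) w := lift_inl _ _ _ _

theorem embed_inr (n : ℕ) (g : BraidGroup n) : embed n (inr g) = braidIncl n g := lift_inr _ _ _ _

theorem embed_loop (n k : ℕ) : embed n (loop n k) = pureLoop n k := by
  rw [loop, embed_inl, FreeGroup.lift_apply_of]

theorem embed_cross {n j : ℕ} (hj : j + 1 < n) : embed n (cross n j) = natGen (n + 1) j := by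
  rw [cross, embed_inr, braidIncl_natGen hj]

theorem natGen_mul_rep {n j k : ℕ} (hj : j < n) (hk : k ≤ n) :
    natGen (n + 1) j * rep n k = rep n (Equiv.swap j (j + 1) k) * embed n (label n j k) := by
  rw [label, if_neg (by omega)]
  split_ifs with h1 h2 h3
  · rw [Equiv.swap_apply_of_ne_of_ne (by omega) (by omega), embed_cross (by omega),
      (commute_natGen_rep h1 hk).eq]
  · subst h2
    rw [Equiv.swap_apply_right, map_one, mul_one, natGen_mul_rep_succ]
  · subst h3
    rw [Equiv.swap_apply_left, embed_loop, pureLoop, if_pos hj, mul_inv_cancel_left]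
  · rw [Equiv.swap_apply_of_ne_of_ne (by omega) (by omega), embed_cross (by omega)]
    have := (semiconjBy_rep (n := n) (show k ≤ j - 1 by omega) (by omega)).eq
    rw [this, Nat.sub_add_cancel (by omega)]

/-! ### Underlying permutations and equivariance -/

/-- The action of `B_n` on the natural numbers through `S_n`. -/
def natPerm (n : ℕ) : BraidGroup n →* Equiv.Perm ℕ :=
  BraidGroup.lift (fun i => Equiv.swap i (i + 1))
    { comm := fun i j h _ => by
        refine Equiv.ext fun x => ?_
        simp only [Equiv.Perm.mul_apply, Equiv.swap_apply_def]
        grind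
      braid := fun i _ => by
        refine Equiv.ext fun x => ?_
        simp only [Equiv.Perm.mul_apply, Equiv.swap_apply_def]
        grind }

theorem natPerm_natGen {n i : ℕ} (hi : i + 1 < n) :
    natPerm n (natGen n i) = Equiv.swap i (i + 1) := lift_natGen _ hi

theorem natPerm_coe {n : ℕ} (x : BraidGroup n) :
    ∀ k : Fin n, natPerm n x k = (toPerm n x k : ℕ) := by
  induction x using BraidGroup.induction with
  | gen i hi =>
    intro k
    rw [natPerm_natGen hi, toPerm_natGen hi]
    simp only [Equiv.swap_apply_def, Fin.ext_iff]
    grind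
  | one => simp
  | mul x y hx hy => intro k; simp [hx, hy]
  | inv x hx =>
    intro k
    have := hx ((toPerm n x)⁻¹ k)
    rw [← Equiv.Perm.mul_apply, mul_inv_cancel, Equiv.Perm.one_apply] at this
    rw [map_inv, map_inv, Equiv.Perm.inv_eq_iff_eq, this]

theorem natPerm_of_le {n : ℕ} (x : BraidGroup n) : ∀ {k : ℕ}, n ≤ k → natPerm n x k = k := by
  induction x using BraidGroup.induction with
  | gen i hi =>
    intro k hk
    rw [natPerm_natGen hi, Equiv.swap_apply_of_ne_of_ne (by omega) (by omega)]
  | one => simp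
  | mul x y hx hy => intro k hk; simp [hx hk, hy hk]
  | inv x hx => intro k hk; rw [map_inv, Equiv.Perm.inv_eq_iff_eq, hx hk]

theorem natPerm_eq_one_iff {n : ℕ} (x : BraidGroup n) : natPerm n x = 1 ↔ toPerm n x = 1 := by
  constructor
  · intro h
    refine Equiv.ext fun k => Fin.ext ?_
    rw [← natPerm_coe, h]
    rfl
  · intro h
    refine Equiv.ext fun k => ?_
    rcases Nat.lt_or_ge k n with hk | hk
    · rw [show k = ((⟨k, hk⟩ : Fin n) : ℕ) from rfl, natPerm_coe, h]
      rfl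
    · exact natPerm_of_le x hk

theorem strandAction_fst {n : ℕ} (x : BraidGroup (n + 1)) :
    ∀ p, (strandAction n x p).1 = natPerm (n + 1) x p.1 := by
  induction x using BraidGroup.induction with
  | gen i hi =>
    intro p
    rw [strandAction_natGen (by omega), natPerm_natGen hi]
    rfl
  | one => simp
  | mul x y hx hy => intro p; simp [hx, hy]
  | inv x hx =>
    intro p
    have := hx ((strandAction n x)⁻¹ p)
    rw [← Equiv.Perm.mul_apply, mul_inv_cancel, Equiv.Perm.one_apply] at this
    rw [map_inv, map_inv, eq_comm, Equiv.Perm.inv_eq_iff_eq, this]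

theorem natPerm_le_iff {n : ℕ} (x : BraidGroup (n + 1)) (k : ℕ) :
    natPerm (n + 1) x k ≤ n ↔ k ≤ n := by
  rcases Nat.lt_or_ge n k with hk | hk
  · rw [natPerm_of_le x hk]
  · have := natPerm_coe x ⟨k, by omega⟩
    simp only at this
    rw [this]
    omega

/-- The map `(k, d) ↦ rep k * embed d` intertwines the formal action with left multiplication in
`B_{n+1}`; on generators this is `natGen_mul_rep`. -/
theorem rep_mul_embed_strandAction {n : ℕ} (x : BraidGroup (n + 1)) : ∀ p, p.1 ≤ n →
    rep n (strandAction n x p).1 * embed n (strandAction n x p).2 =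
      x * (rep n p.1 * embed n p.2) := by
  induction x using BraidGroup.induction with
  | gen j hj =>
    rintro ⟨k, d⟩ hk
    rw [strandAction_natGen (by omega), strandPerm_apply, map_mul, ← mul_assoc, ← mul_assoc,
      natGen_mul_rep (by omega) hk]
  | one => simp
  | mul x y hx hy =>
    intro p hp
    rw [map_mul, Equiv.Perm.mul_apply, hx _ (by rwa [strandAction_fst, natPerm_le_iff]), hy p hp,
      mul_assoc]
  | inv x hx =>
    intro p hp
    have := hx (strandAction n x⁻¹ p) (by rwa [strandAction_fst, natPerm_le_iff])
    rw [← Equiv.Perm.mul_apply, ← map_mul, mul_inv_cancel, map_one, Equiv.Perm.one_apply] at this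
    rw [this, inv_mul_cancel_left]

theorem strandAction_mul_right {n : ℕ} (x : BraidGroup (n + 1)) (d : StrandGroup n) : ∀ p,
    strandAction n x (p.1, p.2 * d) = ((strandAction n x p).1, (strandAction n x p).2 * d) := by
  induction x using BraidGroup.induction with
  | gen j hj =>
    intro p
    rw [strandAction_natGen (by omega)]
    obtain ⟨k, c⟩ := p
    simp only [strandPerm_apply, mul_assoc]
  | one => simp
  | mul x y hx hy => intro p; simp [hx, hy]
  | inv x hx =>
    intro p
    have := hx (strandAction n x⁻¹ p)
    rw [← Equiv.Perm.mul_apply, ← map_mul, mul_inv_cancel, map_one, Equiv.Perm.one_apply] at this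
    rw [← this, ← Equiv.Perm.mul_apply, ← map_mul, inv_mul_cancel, map_one, Equiv.Perm.one_apply]

end StrandGroup

/-! ### The label of a pure braid -/

namespace StrandGroup

open SemidirectProduct BraidGroup
open FreeGroup (of artinGen artinGen_of isBraidSeq_artinGen)

theorem strandAction_apply {n : ℕ} (x : BraidGroup (n + 1)) (k : ℕ) (d : StrandGroup n) :
    strandAction n x (k, d) = ((strandAction n x (k, 1)).1, (strandAction n x (k, 1)).2 * d) := by
  simpa using strandAction_mul_right x d (k, 1)

/-- The projection of the pure braid group on `n + 1` strands, with values in the extension of the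
braid group on `n` strands by a free group. -/
def strandLabel (n : ℕ) : (natPerm (n + 1)).ker →* StrandGroup n where
  toFun x := (strandAction n x (n, 1)).2
  map_one' := by simp
  map_mul' x y := by
    have hy : (strandAction n y (n, 1)).1 = n := by
      rw [strandAction_fst, MonoidHom.mem_ker.1 y.2]; rfl
    rw [Subgroup.coe_mul, map_mul, Equiv.Perm.mul_apply,
      show strandAction n y (n, 1) = (n, (strandAction n y (n, 1)).2) from Prod.ext hy rfl,
      strandAction_apply]

theorem strandLabel_eq {n : ℕ} (x : (natPerm (n + 1)).ker) {k : ℕ} {d : StrandGroup n}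
    (h : strandAction n x (n, 1) = (k, d)) : strandLabel n x = d :=
  congrArg Prod.snd h

/-- Equivariance at the base point `(n, 1)`, which a pure braid keeps over position `n`, where the
representative is `1`. In particular `strandLabel` is injective. -/
theorem embed_strandLabel {n : ℕ} (x : (natPerm (n + 1)).ker) : embed n (strandLabel n x) = x := by
  have := rep_mul_embed_strandAction (x : BraidGroup (n + 1)) (n, 1) le_rfl
  rw [strandAction_fst, MonoidHom.mem_ker.1 x.2] at this
  simp only [Equiv.Perm.one_apply, rep_self, one_mul, map_one, mul_one] at this
  exact this

theorem strandAction_braidIncl {n : ℕ} (g : BraidGroup n) : ∀ d : StrandGroup n,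
    strandAction n (braidIncl n g) (n, d) = (n, inr g * d) := by
  induction g using BraidGroup.induction with
  | gen j hj =>
    intro d
    rw [braidIncl_natGen hj, strandAction_natGen (by omega), strandPerm_of_lt hj le_rfl, cross]
  | one => simp
  | mul x y hx hy => intro d; simp [hx, hy, mul_assoc]
  | inv x hx =>
    intro d
    rw [map_inv, map_inv, Equiv.Perm.inv_eq_iff_eq, hx, map_inv, mul_inv_cancel_left]

theorem strandAction_rep {n k : ℕ} (hk : k ≤ n) (d : StrandGroup n) :
    strandAction n (rep n k) (n, d) = (k, d) := by
  induction hk using Nat.decreasingInduction with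
  | self => simp [rep_self]
  | of_succ k hk ih =>
    rw [← natGen_mul_rep_succ, map_mul, Equiv.Perm.mul_apply, ih, strandAction_natGen hk,
      strandPerm_succ]

theorem strandAction_pureLoop {n k : ℕ} (hk : k < n) (d : StrandGroup n) :
    strandAction n (pureLoop n k) (n, d) = (n, loop n k * d) := by
  rw [pureLoop, if_pos hk, map_mul, map_mul, Equiv.Perm.mul_apply, Equiv.Perm.mul_apply,
    strandAction_rep hk.le, strandAction_natGen hk, strandPerm_self hk.le, map_inv,
    Equiv.Perm.inv_eq_iff_eq, strandAction_rep hk]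

theorem pureLoop_mem_ker (n k : ℕ) : pureLoop n k ∈ (natPerm (n + 1)).ker := by
  by_cases hk : k < n
  · rw [pureLoop_eq hk, MonoidHom.mem_ker]
    simp [natPerm_natGen (show k + 1 < n + 1 by omega)]
  · rw [pureLoop, if_neg hk]
    exact one_mem _

theorem embed_inl_mem_ker (n : ℕ) (w : FreeGroup ℕ) :
    embed n (inl w) ∈ (natPerm (n + 1)).ker := by
  rw [embed_inl]
  induction w using FreeGroup.induction_on with
  | C1 => simp
  | of k => rw [FreeGroup.lift_apply_of]; exact pureLoop_mem_ker n k
  | inv_of k h => rw [map_inv]; exact inv_mem h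
  | mul x y hx hy => rw [map_mul]; exact mul_mem hx hy

theorem natPerm_braidIncl {n : ℕ} (g : BraidGroup n) :
    natPerm (n + 1) (braidIncl n g) = natPerm n g := by
  refine DFunLike.congr_fun (f := (natPerm (n + 1)).comp (braidIncl n)) (hom_ext fun i hi => ?_) g
  rw [MonoidHom.comp_apply, braidIncl_natGen hi, natPerm_natGen hi, natPerm_natGen (by omega)]

theorem strandAction_revRun {n k : ℕ} (hk : k ≤ n) :
    ∃ w, strandAction n (revRun (natGen (n + 1)) k) (0, 1) = (k, inl w) := by
  induction k with
  | zero => exact ⟨1, by simp [revRun]⟩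
  | succ k ih =>
    obtain ⟨w, hw⟩ := ih (by omega)
    refine ⟨of k * w, ?_⟩
    rw [revRun, map_mul, Equiv.Perm.mul_apply, hw, strandAction_natGen hk,
      strandPerm_self (by omega), map_mul, loop]

theorem braidIncl_halfTwist (n : ℕ) :
    braidIncl n (halfTwist n) = twist (natGen (n + 1)) n := by
  rw [halfTwist_eq_twist, map_twist]
  exact twist_congr fun i hi => braidIncl_natGen hi

/-- In the factorization of the full twist, the run carries the last position to `0` with no label
and the reversed run brings it back, collecting only loops. The `B_n`-part of the label is therefore
`Δ_n^2`. -/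
theorem strandAction_halfTwist_sq (n : ℕ) : ∃ w, strandAction n (halfTwist (n + 1) ^ 2) (n, 1) =
    (n, inr (halfTwist n) * (inl w * inr (halfTwist n))) := by
  obtain ⟨w, hw⟩ := strandAction_revRun (le_refl n)
  refine ⟨w, ?_⟩
  rw [halfTwist_eq_twist, (isBraidSeq_natGen (n + 1)).twist_sq_succ (by omega),
    ← braidIncl_halfTwist, ← rep_zero]
  simp only [map_mul, Equiv.Perm.mul_apply]
  rw [strandAction_braidIncl, strandAction_rep (by omega), strandAction_apply (revRun _ _), hw,
    strandAction_braidIncl, mul_one]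

/-- By induction through `twist_sq_succ`: the middle factor is a palindrome in the generators, so
its transpositions cancel in pairs. -/
theorem halfTwist_sq_mem_ker (n : ℕ) : halfTwist n ^ 2 ∈ (natPerm n).ker := by
  induction n with
  | zero => exact one_mem _
  | succ n ih =>
    rw [MonoidHom.mem_ker] at *
    rw [halfTwist_eq_twist, (isBraidSeq_natGen (n + 1)).twist_sq_succ (by omega),
      ← braidIncl_halfTwist]
    have h : ∀ k, k ≤ n → natPerm (n + 1) (revRun (natGen (n + 1)) k * run (natGen (n + 1)) k) = 1 := by
      intro k
      induction k with
      | zero => intro _; simp [run, revRun]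
      | succ k ih =>
        intro hk
        rw [run, revRun, mul_assoc, ← mul_assoc (revRun _ _), map_mul, map_mul, ih (by omega),
          natPerm_natGen (by omega), one_mul, Equiv.swap_mul_self]
    rw [map_mul, map_mul, h n le_rfl, mul_one, natPerm_braidIncl, ← map_mul, ← pow_two, ih]

end StrandGroup

/-! ### The centre of the pure braid group -/

namespace BraidGroup

open SemidirectProduct StrandGroup
open FreeGroup (of)

/-- `B_2` is cyclic on its only generator, which is also the half twist, and an odd power of it maps
to a nontrivial transposition. -/
theorem mem_zpowers_halfTwist_sq_two {x : BraidGroup 2} (hx : x ∈ (natPerm 2).ker) :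
    x ∈ Subgroup.zpowers (halfTwist 2 ^ 2) := by
  have hg : x ∈ Subgroup.zpowers (natGen 2 0) := by
    clear hx
    induction x using BraidGroup.induction with
    | gen i hi =>
      obtain rfl : i = 0 := by omega
      exact Subgroup.mem_zpowers _
    | one => exact one_mem _
    | mul x y hx hy => exact mul_mem hx hy
    | inv x hx => exact inv_mem hx
  obtain ⟨m, rfl⟩ := hg
  rw [show halfTwist 2 = natGen 2 0 by rw [halfTwist_eq_twist]; simp [twist, run]]
  rcases Int.even_or_odd' m with ⟨k, rfl | rfl⟩
  · exact ⟨k, by simp [zpow_mul]⟩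
  · exfalso
    have h1 : (Equiv.swap (0 : ℕ) 1) ^ 2 = 1 := by rw [pow_two, Equiv.swap_mul_self]
    have h2 : natPerm 2 (natGen 2 0) = Equiv.swap (0 : ℕ) 1 := natPerm_natGen (by omega)
    rw [MonoidHom.mem_ker] at hx
    simp only [map_zpow, h2] at hx
    rw [zpow_add, zpow_mul, zpow_ofNat, h1, one_zpow, one_mul, zpow_one] at hx
    have := DFunLike.congr_fun hx 0
    simp at this

/-- The centre of the pure braid group is generated by the full twist. -/
theorem mem_zpowers_halfTwist_sq {n : ℕ} (hn : 2 ≤ n) : ∀ {x : BraidGroup n},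
    x ∈ (natPerm n).ker → (∀ y ∈ (natPerm n).ker, Commute x y) →
    x ∈ Subgroup.zpowers (halfTwist n ^ 2) := by
  induction n, hn using Nat.le_induction with
  | base => exact fun hx _ => mem_zpowers_halfTwist_sq_two hx
  | succ n hn ih =>
    intro x hx hc
    have hcl : ∀ {x y : (natPerm (n + 1)).ker}, Commute (x : BraidGroup (n + 1)) y →
        Commute (strandLabel n x) (strandLabel n y) := fun {x y} h =>
      Commute.map (Subtype.ext h : Commute x y) (strandLabel n)
    have hker : ∀ z : (natPerm (n + 1)).ker, (strandLabel n z).right ∈ (natPerm n).ker := by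
      intro z
      have h1 := embed_strandLabel z
      rw [← inl_left_mul_inr_right (strandLabel n z), map_mul, embed_inr] at h1
      have h2 := z.2
      rw [← h1, (natPerm (n + 1)).ker.mul_mem_cancel_left (embed_inl_mem_ker n _),
        MonoidHom.mem_ker, natPerm_braidIncl] at h2
      exact h2
    -- Pure braids of `B_n`, included in `B_{n+1}`, commute with `x`; projecting their labels shows
    -- that the `B_n`-part of `x` satisfies the induction hypothesis.
    have hright : (strandLabel n ⟨x, hx⟩).right ∈ Subgroup.zpowers (halfTwist n ^ 2) := by
      refine ih (hker _) fun p hp => ?_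
      have hp' : braidIncl n p ∈ (natPerm (n + 1)).ker := by
        rw [MonoidHom.mem_ker, natPerm_braidIncl, MonoidHom.mem_ker.1 hp]
      have h1 := hcl (x := ⟨x, hx⟩) (y := ⟨_, hp'⟩) (hc _ hp')
      rw [strandLabel_eq ⟨_, hp'⟩ (strandAction_braidIncl p 1), mul_one] at h1
      simpa using h1.map (rightHom : StrandGroup n →* BraidGroup n)
    obtain ⟨m, hm⟩ := hright
    let z : (natPerm (n + 1)).ker := ⟨_, halfTwist_sq_mem_ker (n + 1)⟩
    obtain ⟨w, hw⟩ := strandAction_halfTwist_sq n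
    have hz : (strandLabel n z).right = halfTwist n ^ 2 := by
      rw [strandLabel_eq z hw]
      simp [pow_two]
    -- Removing the full twists leaves an element whose label lies in the free group; it still
    -- commutes with the loops because the full twist is central.
    let y : (natPerm (n + 1)).ker := ⟨x, hx⟩ * z ^ (-m)
    have hyr : (strandLabel n y).right = 1 := by
      have : (rightHom (strandLabel n y) : BraidGroup n) = 1 := by
        simp only [y, map_mul, map_zpow, rightHom_eq_right, hz, ← hm]
        simp
      exact this
    have hyc : ∀ k, k < n → Commute (strandLabel n y).left (of k) := by
      intro k hk
      have h1 : Commute (y : BraidGroup (n + 1)) (pureLoop n k) :=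
        (hc _ (pureLoop_mem_ker n k)).mul_left
          (((commute_halfTwist_sq (n + 1) _).zpow_left (-m)))
      have h2 := hcl (x := y) (y := ⟨_, pureLoop_mem_ker n k⟩) h1
      rw [strandLabel_eq ⟨_, pureLoop_mem_ker n k⟩ (strandAction_pureLoop hk 1), mul_one, loop] at h2
      have h3 := congrArg SemidirectProduct.left h2.eq
      simpa [hyr, Commute, SemiconjBy] using h3
    have hy1 : strandLabel n y = 1 :=
      SemidirectProduct.ext
        -- Here `2 ≤ n` enters: it provides two distinct loops.
        (FreeGroup.eq_one_of_commute_of_zero_of_one (hyc 0 (by omega)) (hyc 1 (by omega))) hyr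
    have hy : (y : BraidGroup (n + 1)) = 1 := by
      rw [← embed_strandLabel y, hy1, map_one]
    refine ⟨m, ?_⟩
    have hy' : x * (halfTwist (n + 1) ^ 2) ^ (-m) = 1 := hy
    rw [zpow_neg, mul_inv_eq_one] at hy'
    exact hy'.symm

end BraidGroup

/-! ### The group `B_3`, its map to `SL_2(ℤ)` and its centre -/

namespace BraidGroup

open Matrix (SpecialLinearGroup)

/-- The images in `SL_2(ℤ)` of the generators of `B_3`. -/
def slGen (i : ℕ) : SpecialLinearGroup (Fin 2) ℤ :=
  if i = 0 then ⟨!![1, 1; 0, 1], by simp⟩ else ⟨!![1, 0; -1, 1], by simp⟩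

theorem isBraidSeq_slGen : IsBraidSeq 3 slGen where
  comm i j h hj := by omega
  braid i h := by
    obtain rfl : i = 0 := by omega
    apply Subtype.ext
    change (!![1, 1; 0, 1] * !![1, 0; -1, 1] * !![1, 1; 0, 1] : Matrix (Fin 2) (Fin 2) ℤ) =
      !![1, 0; -1, 1] * !![1, 1; 0, 1] * !![1, 0; -1, 1]
    simp

/-- The standard homomorphism `B_3 → SL_2(ℤ)`. -/
def toSL : BraidGroup 3 →* SpecialLinearGroup (Fin 2) ℤ := lift slGen isBraidSeq_slGen

theorem toSL_zero : (toSL (natGen 3 0) : Matrix (Fin 2) (Fin 2) ℤ) = !![1, 1; 0, 1] := by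
  rw [toSL, lift_natGen _ (by omega)]; rfl

theorem toSL_one : (toSL (natGen 3 1) : Matrix (Fin 2) (Fin 2) ℤ) = !![1, 0; -1, 1] := by
  rw [toSL, lift_natGen _ (by omega)]; rfl

theorem toSL_one_inv : (toSL (natGen 3 1)⁻¹ : Matrix (Fin 2) (Fin 2) ℤ) = !![1, 0; 1, 1] := by
  rw [map_inv, Matrix.SpecialLinearGroup.coe_inv, toSL_one, Matrix.adjugate_fin_two_of]
  simp

theorem halfTwist_three : halfTwist 3 = natGen 3 0 * natGen 3 1 * natGen 3 0 := by
  rw [halfTwist_eq_twist]; simp [twist, run]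

theorem toSL_halfTwist : (toSL (halfTwist 3) : Matrix (Fin 2) (Fin 2) ℤ) = !![0, 1; -1, 0] := by
  rw [halfTwist_three, map_mul, map_mul, Matrix.SpecialLinearGroup.coe_mul,
    Matrix.SpecialLinearGroup.coe_mul, toSL_zero, toSL_one]
  simp

theorem toSL_rotation : (toSL (natGen 3 0 * natGen 3 1) : Matrix (Fin 2) (Fin 2) ℤ) =
    !![0, 1; -1, 1] := by
  rw [map_mul, Matrix.SpecialLinearGroup.coe_mul, toSL_zero, toSL_one]
  simp

theorem toSL_halfTwist_sq : toSL (halfTwist 3 ^ 2) = -1 := by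
  apply Subtype.ext
  rw [map_pow, Matrix.SpecialLinearGroup.coe_pow, toSL_halfTwist, pow_two]
  ext i j
  fin_cases i <;> fin_cases j <;> simp

theorem toSL_surjective : Function.Surjective toSL := by
  rw [← MonoidHom.range_eq_top, eq_top_iff, ← SpecialLinearGroup.SL2Z_generators,
    Subgroup.closure_le]
  rintro x (rfl | rfl)
  · refine ⟨(halfTwist 3)⁻¹, Subtype.ext ?_⟩
    rw [map_inv, Matrix.SpecialLinearGroup.coe_inv, toSL_halfTwist, Matrix.adjugate_fin_two_of,
      ModularGroup.coe_S]
    simp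
  · exact ⟨natGen 3 0, Subtype.ext (by rw [toSL_zero, ModularGroup.coe_T])⟩

/-- The positive words in `σ_1` and `σ_2⁻¹`. -/
inductive IsPosWord : BraidGroup 3 → Prop
  | one : IsPosWord 1
  | mul_fst (w : BraidGroup 3) : IsPosWord w → IsPosWord (w * natGen 3 0)
  | mul_snd (w : BraidGroup 3) : IsPosWord w → IsPosWord (w * (natGen 3 1)⁻¹)

/-- Both letters map to nonnegative elementary matrices. Each letter adds one column to the other;
columns stay nonzero, so the sum of the entries strictly grows from its initial value `2`. -/
theorem IsPosWord.toSL_eq {w : BraidGroup 3} (hw : IsPosWord w) : ∃ a b c d : ℤ,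
    (toSL w : Matrix (Fin 2) (Fin 2) ℤ) = !![a, b; c, d] ∧ 0 ≤ a ∧ 0 ≤ b ∧ 0 ≤ c ∧ 0 ≤ d ∧
      1 ≤ a + c ∧ 1 ≤ b + d ∧ (w = 1 ∨ 2 < a + b + c + d) := by
  induction hw with
  | one => exact ⟨1, 0, 0, 1, by rw [map_one, Matrix.SpecialLinearGroup.coe_one,
      Matrix.one_fin_two], by simp⟩
  | mul_fst w _ ih =>
    obtain ⟨a, b, c, d, h, _, _, _, _, _, _, _⟩ := ih
    refine ⟨a, a + b, c, c + d, ?_, by omega⟩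
    rw [map_mul, Matrix.SpecialLinearGroup.coe_mul, h, toSL_zero]
    simp
  | mul_snd w _ ih =>
    obtain ⟨a, b, c, d, h, _, _, _, _, _, _, _⟩ := ih
    refine ⟨a + b, b, c + d, d, ?_, by omega⟩
    rw [map_mul, Matrix.SpecialLinearGroup.coe_mul, h, toSL_one_inv]
    simp

/-- The elements `Δ^{2k} Δ^f w (σ_1 σ_2)^e` of `B_3`, where `w` is a positive word. -/
def HasNormalForm (x : BraidGroup 3) : Prop :=
  ∃ (k : ℤ) (f e : ℕ) (w : BraidGroup 3), f < 2 ∧ e < 3 ∧ IsPosWord w ∧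
    x = (halfTwist 3 ^ 2) ^ k * (halfTwist 3 ^ f * w * (natGen 3 0 * natGen 3 1) ^ e)

theorem rotation_pow_three : (natGen 3 0 * natGen 3 1) ^ 3 = halfTwist 3 ^ 2 := by
  have h := (isBraidSeq_natGen 3).braid 0 (by omega)
  rw [halfTwist_three, pow_two]
  nth_rw 2 [h]
  simp only [pow_succ, pow_zero, one_mul, mul_assoc, zero_add]

/-- Modulo the central `Δ^2`, with `u = σ_1 σ_2` and `v = Δ`, the positive letters are `u^2 v` and
`u v`. Positive words are thus the alternating words of the free product `ℤ/3 * ℤ/2`. -/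
theorem rotation_sq_mul_halfTwist :
    (natGen 3 0 * natGen 3 1) ^ 2 * halfTwist 3 = halfTwist 3 ^ 2 * natGen 3 0 := by
  rw [← rotation_pow_three, halfTwist_three]
  simp only [pow_succ, pow_zero, one_mul, mul_assoc]

theorem rotation_mul_halfTwist :
    natGen 3 0 * natGen 3 1 * halfTwist 3 = halfTwist 3 ^ 2 * (natGen 3 1)⁻¹ := by
  have h := (isBraidSeq_natGen 3).semiconjBy_twist (i := 1) (j := 0) (k := 3) rfl le_rfl
  rw [← halfTwist_eq_twist] at h
  rw [eq_mul_inv_iff_mul_eq, mul_assoc, h.eq, ← mul_assoc, ← halfTwist_three, pow_two]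

theorem HasNormalForm.central_mul {x : BraidGroup 3} (hx : HasNormalForm x) (m : ℤ) :
    HasNormalForm ((halfTwist 3 ^ 2) ^ m * x) := by
  obtain ⟨k, f, e, w, hf, he, hw, rfl⟩ := hx
  exact ⟨m + k, f, e, w, hf, he, hw, by rw [← mul_assoc, zpow_add]⟩

theorem HasNormalForm.of_central_mul {x : BraidGroup 3} {m : ℤ}
    (hx : HasNormalForm ((halfTwist 3 ^ 2) ^ m * x)) : HasNormalForm x := by
  simpa using hx.central_mul (-m)

theorem HasNormalForm.mul_rotation {x : BraidGroup 3} (hx : HasNormalForm x) :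
    HasNormalForm (x * (natGen 3 0 * natGen 3 1)) := by
  obtain ⟨k, f, e, w, hf, he, hw, rfl⟩ := hx
  rw [mul_assoc, mul_assoc _ _ (natGen 3 0 * natGen 3 1), ← pow_succ]
  refine HasNormalForm.central_mul ?_ k
  rcases Nat.lt_or_ge (e + 1) 3 with h | h
  · exact ⟨0, f, e + 1, w, hf, h, hw, by simp⟩
  · obtain rfl : e = 2 := by omega
    refine ⟨1, f, 0, w, hf, by omega, hw, ?_⟩
    rw [rotation_pow_three, ← (commute_halfTwist_sq 3 _).eq]
    simp

/-- A nonzero power of the rotation joins `Δ` to form a new positive letter. With no rotation, `Δ`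
turns the last letter back into a power of the rotation, or toggles `f` when the word is empty. -/
theorem HasNormalForm.mul_halfTwist {x : BraidGroup 3} (hx : HasNormalForm x) :
    HasNormalForm (x * halfTwist 3) := by
  obtain ⟨k, f, e, w, hf, he, hw, rfl⟩ := hx
  rw [mul_assoc, mul_assoc _ _ (halfTwist 3)]
  refine HasNormalForm.central_mul ?_ k
  have hz := commute_halfTwist_sq 3
  rcases (show e = 0 ∨ e = 1 ∨ e = 2 by omega) with rfl | rfl | rfl
  · rw [pow_zero, one_mul]
    cases hw with
    | one =>
      rcases (show f = 0 ∨ f = 1 by omega) with rfl | rfl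
      · exact ⟨0, 1, 0, 1, by omega, by omega, .one, by simp⟩
      · exact ⟨1, 0, 0, 1, by omega, by omega, .one, by simp [pow_two]⟩
    | mul_fst w hw =>
      refine ⟨0, f, 2, w, hf, by omega, hw, ?_⟩
      have h : natGen 3 0 * halfTwist 3 = (natGen 3 0 * natGen 3 1) ^ 2 := by
        refine mul_left_cancel (a := halfTwist 3 ^ 2) ?_
        rw [← mul_assoc, ← rotation_sq_mul_halfTwist, mul_assoc, ← pow_two, (hz _).eq]
      rw [← h]
      simp [mul_assoc]
    | mul_snd w hw =>
      refine ⟨0, f, 1, w, hf, by omega, hw, ?_⟩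
      have h : (natGen 3 1)⁻¹ * halfTwist 3 = natGen 3 0 * natGen 3 1 := by
        refine mul_left_cancel (a := halfTwist 3 ^ 2) ?_
        rw [← mul_assoc, ← rotation_mul_halfTwist, mul_assoc, ← pow_two, (hz _).eq]
      rw [pow_one, ← h]
      simp [mul_assoc]
  · refine ⟨1, f, 0, _, hf, by omega, hw.mul_snd, ?_⟩
    rw [pow_one, rotation_mul_halfTwist, ← mul_assoc, ← (hz (halfTwist 3 ^ f * w)).eq]
    simp [mul_assoc]
  · refine ⟨1, f, 0, _, hf, by omega, hw.mul_fst, ?_⟩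
    rw [rotation_sq_mul_halfTwist, ← mul_assoc, ← (hz (halfTwist 3 ^ f * w)).eq]
    simp [mul_assoc]

theorem hasNormalForm (x : BraidGroup 3) : HasNormalForm x := by
  have hz := commute_halfTwist_sq 3
  have h0 : ∀ y, HasNormalForm y → HasNormalForm (y * natGen 3 0) := by
    intro y hy
    refine HasNormalForm.of_central_mul (m := 1) ?_
    have := hy.mul_rotation.mul_rotation.mul_halfTwist
    rwa [mul_assoc y, ← pow_two, mul_assoc, rotation_sq_mul_halfTwist, ← mul_assoc, ← (hz y).eq,
      mul_assoc, ← zpow_one (halfTwist 3 ^ 2)] at this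
  have h1' : ∀ y, HasNormalForm y → HasNormalForm (y * (natGen 3 1)⁻¹) := by
    intro y hy
    refine HasNormalForm.of_central_mul (m := 1) ?_
    have := hy.mul_rotation.mul_halfTwist
    rwa [mul_assoc, rotation_mul_halfTwist, ← mul_assoc, ← (hz y).eq,
      mul_assoc, ← zpow_one (halfTwist 3 ^ 2)] at this
  have hv : ∀ y, HasNormalForm y → HasNormalForm (y * (halfTwist 3)⁻¹) := by
    intro y hy
    refine HasNormalForm.of_central_mul (m := 1) ?_
    have := hy.mul_halfTwist
    rwa [zpow_one, ← mul_assoc, (hz y).eq, mul_assoc, pow_two, mul_inv_cancel_right]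
  have hu : ∀ y, HasNormalForm y → HasNormalForm (y * (natGen 3 0 * natGen 3 1)⁻¹) := by
    intro y hy
    refine HasNormalForm.of_central_mul (m := 1) ?_
    have := hy.mul_rotation.mul_rotation
    rwa [zpow_one, ← mul_assoc, (hz y).eq, mul_assoc, ← rotation_pow_three, pow_succ,
      mul_inv_cancel_right, pow_two, ← mul_assoc]
  have h0' : ∀ y, HasNormalForm y → HasNormalForm (y * (natGen 3 0)⁻¹) := by
    intro y hy
    have := (hv y hy).mul_rotation
    rwa [halfTwist_three, mul_assoc, mul_inv_rev _ (natGen 3 0), inv_mul_cancel_right] at this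
  have h1 : ∀ y, HasNormalForm y → HasNormalForm (y * natGen 3 1) := by
    intro y hy
    have := (h0' y hy).mul_rotation
    rwa [← mul_assoc, inv_mul_cancel_right] at this
  -- Stated as an equivalence for all `y`, so that the inverse case of the induction is immediate.
  have key : ∀ y, HasNormalForm (y * x) ↔ HasNormalForm y := by
    induction x using BraidGroup.induction with
    | gen i hi =>
      intro y
      rcases (show i = 0 ∨ i = 1 by omega) with rfl | rfl
      · exact ⟨fun h => by simpa using h0' _ h, h0 y⟩
      · exact ⟨fun h => by simpa using h1' _ h, h1 y⟩
    | one => simp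
    | mul x y hx hy => intro w; rw [← mul_assoc, hy, hx]
    | inv x hx => intro w; rw [← hx, inv_mul_cancel_right]
  have := (key 1).2 ⟨0, 0, 0, 1, by omega, by omega, .one, by simp⟩
  rwa [one_mul] at this

/-- In normal form, a scalar image `±1` would make the matrix of `w` equal to `±` a product of
powers of the matrices of `Δ` and `σ_1 σ_2`. Unless `f = e = 0` such a matrix has entries of both
signs, contrary to nonnegativity; if `f = e = 0`, the entry sum forces `w = 1`. -/
theorem mem_zpowers_of_toSL {x : BraidGroup 3} (hx : toSL x = 1 ∨ toSL x = -1) :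
    x ∈ Subgroup.zpowers (halfTwist 3 ^ 2) := by
  obtain ⟨k, f, e, w, hf, he, hw, rfl⟩ := hasNormalForm x
  have h1 : toSL (halfTwist 3 ^ f * w * (natGen 3 0 * natGen 3 1) ^ e) = 1 ∨
      toSL (halfTwist 3 ^ f * w * (natGen 3 0 * natGen 3 1) ^ e) = -1 := by
    rw [map_mul, map_zpow, toSL_halfTwist_sq] at hx
    rcases Int.even_or_odd k with hk | hk
    · rwa [hk.neg_one_zpow, one_mul] at hx
    · rw [hk.neg_one_zpow, neg_one_mul, neg_eq_iff_eq_neg, neg_inj] at hx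
      exact hx.symm
  obtain ⟨a, b, c, d, hM, ha, hb, hc, hd, -, -, hs⟩ := hw.toSL_eq
  have h2 : ∃ r : ℤ, (r = 1 ∨ r = -1) ∧
      !![0, 1; -1, 0] ^ f * !![a, b; c, d] * !![0, 1; -1, 1] ^ e = !![r, 0; 0, r] := by
    rw [← toSL_halfTwist, ← toSL_rotation, ← hM, ← Matrix.SpecialLinearGroup.coe_pow,
      ← Matrix.SpecialLinearGroup.coe_pow, ← Matrix.SpecialLinearGroup.coe_mul,
      ← Matrix.SpecialLinearGroup.coe_mul, ← map_pow, ← map_pow, ← map_mul, ← map_mul]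
    rcases h1 with h | h
    · exact ⟨1, .inl rfl, by rw [h, Matrix.SpecialLinearGroup.coe_one, Matrix.one_fin_two]⟩
    · refine ⟨-1, .inr rfl, ?_⟩
      rw [h, Matrix.SpecialLinearGroup.coe_neg, Matrix.SpecialLinearGroup.coe_one,
        Matrix.one_fin_two]
      simp
  obtain ⟨r, hr, h2⟩ := h2
  have h00 := congrFun₂ h2 0 0
  have h01 := congrFun₂ h2 0 1
  have h10 := congrFun₂ h2 1 0
  have h11 := congrFun₂ h2 1 1
  rcases (show f = 0 ∨ f = 1 by omega) with rfl | rfl <;>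
    rcases (show e = 0 ∨ e = 1 ∨ e = 2 by omega) with rfl | rfl | rfl <;>
    simp [pow_two] at h00 h01 h10 h11
  · rcases hs with rfl | hs
    · exact ⟨k, by simp⟩
    · omega
  all_goals omega

theorem eq_one_or_eq_neg_one_of_mem_center {A : SpecialLinearGroup (Fin 2) ℤ}
    (hA : A ∈ Subgroup.center (SpecialLinearGroup (Fin 2) ℤ)) : A = 1 ∨ A = -1 := by
  obtain ⟨r, hr, h⟩ := Matrix.SpecialLinearGroup.mem_center_iff.1 hA
  rw [Fintype.card_fin] at hr
  rcases sq_eq_sq_iff_eq_or_eq_neg.1 (hr.trans (one_pow 2).symm) with rfl | rfl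
  · exact .inl (Subtype.ext (by rw [← h, map_one, Matrix.SpecialLinearGroup.coe_one]))
  · exact .inr (Subtype.ext (by rw [← h, map_neg, map_one, Matrix.SpecialLinearGroup.coe_neg,
      Matrix.SpecialLinearGroup.coe_one]))

theorem mem_center_iff_toSL {x : BraidGroup 3} : toSL x ∈ Subgroup.center _ ↔
    x ∈ Subgroup.zpowers (halfTwist 3 ^ 2) := by
  refine ⟨fun h => mem_zpowers_of_toSL (eq_one_or_eq_neg_one_of_mem_center h), ?_⟩
  rintro ⟨k, rfl⟩
  simp only [map_zpow, toSL_halfTwist_sq]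
  refine zpow_mem (Subgroup.mem_center_iff.2 fun g => ?_) k
  rw [mul_neg_one, neg_one_mul]

theorem center_three : Subgroup.center (BraidGroup 3) = Subgroup.zpowers (halfTwist 3 ^ 2) := by
  apply le_antisymm
  · intro x hx
    rw [← mem_center_iff_toSL, Subgroup.mem_center_iff]
    intro g
    obtain ⟨y, rfl⟩ := toSL_surjective g
    rw [← map_mul, ← map_mul, Subgroup.mem_center_iff.1 hx]
  · rw [Subgroup.zpowers_le, Subgroup.mem_center_iff]
    exact fun g => (commute_halfTwist_sq 3 g).eq.symm

end BraidGroup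

/-! ### Internal direct products and infinite cyclic subgroups -/

section InternalDirectProduct

variable {G : Type*} [Group G]

theorem IsInternalDirectProduct.nonempty_prod_equiv {K A B : Subgroup G}
    (h : IsInternalDirectProduct K A B) : Nonempty (A × B ≃* K) := by
  let φ : A × B →* G := A.subtype.noncommCoprod B.subtype fun a b => h.commute a a.2 b b.2
  have hr : φ.range = K := by
    refine (MonoidHom.noncommCoprod_range _ _ _).trans ?_
    rw [Subgroup.range_subtype, Subgroup.range_subtype, h.sup_eq]
  have hi : Function.Injective φ := by
    rw [injective_iff_map_eq_one]
    rintro ⟨a, b⟩ hab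
    have hab' : (a : G) * b = 1 := hab
    have ha : (a : G) = (b : G)⁻¹ := eq_inv_of_mul_eq_one_left hab'
    have h1 : (a : G) = 1 := Subgroup.disjoint_def.1 h.disjoint a.2 (ha ▸ inv_mem b.2)
    rw [h1, one_mul] at hab'
    exact Prod.ext (Subtype.ext h1) (Subtype.ext hab')
  exact ⟨(MonoidHom.ofInjective hi).trans (MulEquiv.subgroupCongr hr)⟩

theorem nonempty_zpowers_equiv {z : G} (hz : Function.Injective fun m : ℤ => z ^ m) :
    Nonempty (Subgroup.zpowers z ≃* Multiplicative ℤ) := by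
  have hi : Function.Injective (zpowersHom G z) := fun a b h =>
    hz (a₁ := a.toAdd) (a₂ := b.toAdd) (by simpa using h)
  have hr : (zpowersHom G z).range = Subgroup.zpowers z := by
    ext x
    simp only [MonoidHom.mem_range, Subgroup.mem_zpowers_iff, zpowersHom_apply]
    exact ⟨fun ⟨a, h⟩ => ⟨_, h⟩, fun ⟨a, h⟩ => ⟨Multiplicative.ofAdd a, h⟩⟩
  exact ⟨((MonoidHom.ofInjective hi).trans (MulEquiv.subgroupCongr hr)).symm⟩

/-- Splitting off the last coordinate. -/
def finSuccPiMulEquiv (n : ℕ) :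
    Multiplicative (Fin (n + 1) → ℤ) ≃* (Fin n → Multiplicative ℤ) × Multiplicative ℤ where
  toFun f := (fun i => Multiplicative.ofAdd (f.toAdd i.castSucc),
    Multiplicative.ofAdd (f.toAdd (Fin.last n)))
  invFun p := Multiplicative.ofAdd
    (Fin.snoc (α := fun _ => ℤ) (fun i => (p.1 i).toAdd) p.2.toAdd)
  left_inv f := by
    refine Multiplicative.toAdd.injective (funext fun i => ?_)
    refine Fin.lastCases ?_ (fun i => ?_) i <;> simp
  right_inv p := by simp
  map_mul' f g := rfl

end InternalDirectProduct

/-! ### Exponent sum and infinite order of the full twist -/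

namespace BraidGroup

/-- The exponent sum of a braid. -/
def expSum (n : ℕ) : BraidGroup n →* Multiplicative ℤ :=
  lift (fun _ => Multiplicative.ofAdd 1) ⟨fun _ _ _ _ => rfl, fun _ _ => rfl⟩

theorem expSum_natGen {n i : ℕ} (hi : i + 1 < n) :
    expSum n (natGen n i) = Multiplicative.ofAdd 1 := lift_natGen _ hi

theorem toAdd_run_const (k : ℕ) :
    (run (fun _ => Multiplicative.ofAdd (1 : ℤ)) k).toAdd = k := by
  induction k with
  | zero => rfl
  | succ k ih => rw [run, toAdd_mul, ih]; simp

/-- A crude bound on the exponent sum of the half twist: its positivity is all that infinite order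
requires. -/
theorem le_toAdd_twist_const (k : ℕ) :
    (k : ℤ) ≤ (twist (fun _ => Multiplicative.ofAdd (1 : ℤ)) (k + 1)).toAdd := by
  induction k with
  | zero => simp [twist, run]
  | succ k ih => rw [twist, toAdd_mul, toAdd_run_const]; omega

theorem zpow_halfTwist_sq_injective {n : ℕ} (hn : 2 ≤ n) :
    Function.Injective fun m : ℤ => (halfTwist n ^ 2) ^ m := by
  intro a b h
  have h1 := congrArg (fun x => (expSum n x).toAdd) h
  have h2 : expSum n (halfTwist n) = twist (fun _ => Multiplicative.ofAdd (1 : ℤ)) n := by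
    rw [halfTwist_eq_twist, map_twist]
    exact twist_congr fun i hi => expSum_natGen hi
  have h3 := le_toAdd_twist_const (n - 1)
  rw [Nat.sub_add_cancel (by omega)] at h3
  simp only [map_zpow, map_pow, h2, toAdd_zpow, toAdd_pow, smul_eq_mul] at h1
  refine mul_right_cancel₀ ?_ h1
  simp only [nsmul_eq_mul]
  push_cast [Nat.cast_sub (show 1 ≤ n by omega)] at *
  have : (2 : ℤ) ≤ n := by exact_mod_cast hn
  nlinarith

end BraidGroup

/-! ### Centres of the framed and pure framed braid groups -/

namespace FramedBraidGroup

open BraidGroup SemidirectProduct StrandGroup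

variable {n : ℕ}

/-- The action of braids on framings. -/
abbrev act (n : ℕ) : BraidGroup n →* MulAut (Fin n → Multiplicative ℤ) :=
  (mulAutArrow (G := Equiv.Perm (Fin n)) (A := Fin n) (M := Multiplicative ℤ)).comp (toPerm n)

theorem act_apply (g : BraidGroup n) (h : Fin n → Multiplicative ℤ) (i : Fin n) :
    act n g h i = h ((toPerm n g)⁻¹ i) := rfl

theorem act_eq_of_ker {g : BraidGroup n} (hg : g ∈ (natPerm n).ker)
    (h : Fin n → Multiplicative ℤ) : act n g h = h := by
  funext i
  rw [act_apply, (natPerm_eq_one_iff g).1 hg]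
  rfl

theorem mem_ker_of_act {g : BraidGroup n} (hg : ∀ h, act n g h = h) : g ∈ (natPerm n).ker := by
  rw [MonoidHom.mem_ker, natPerm_eq_one_iff, ← inv_eq_one]
  refine Equiv.ext fun i => ?_
  have h1 := congrFun (hg (Pi.mulSingle i (Multiplicative.ofAdd 1))) i
  rw [act_apply, Pi.mulSingle_eq_same] at h1
  by_contra hne
  change (toPerm n g)⁻¹ i ≠ i at hne
  rw [Pi.mulSingle_eq_of_ne hne] at h1
  exact absurd h1 (by decide)

theorem act_diagonal (g : BraidGroup n) {h : Fin n → Multiplicative ℤ}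
    (hh : h ∈ diagonalSubgroup n) : act n g h = h := by
  obtain ⟨a, rfl⟩ := hh
  rfl

theorem mem_diagonal_of_act {h : Fin n → Multiplicative ℤ} (hh : ∀ g, act n g h = h) :
    h ∈ diagonalSubgroup n := by
  rcases n with - | n
  · exact ⟨1, Subsingleton.elim _ _⟩
  refine ⟨h 0, funext fun i => ?_⟩
  change h 0 = h i
  induction i using Fin.induction with
  | zero => rfl
  | succ i ih =>
    rw [ih]
    have := congrFun (hh (natGen (n + 1) i)) i.castSucc
    rw [act_apply, toPerm_natGen (by omega), Equiv.swap_inv] at this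
    rw [← this]
    congr 1
    exact Equiv.swap_apply_left i.castSucc i.succ

theorem mem_zpowers_ker {g : BraidGroup n} (hg : g ∈ Subgroup.zpowers (halfTwist n ^ 2)) :
    g ∈ (natPerm n).ker := Subgroup.zpowers_le.2 (halfTwist_sq_mem_ker n) hg

theorem commute_of_mem_zpowers {g : BraidGroup n} (hg : g ∈ Subgroup.zpowers (halfTwist n ^ 2))
    (x : BraidGroup n) : Commute g x := by
  obtain ⟨k, rfl⟩ := hg
  exact (commute_halfTwist_sq n x).zpow_left k

theorem mem_pure_iff {x : FramedBraidGroup n} : x ∈ pure n ↔ x.right ∈ (natPerm n).ker := by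
  rw [MonoidHom.mem_ker, natPerm_eq_one_iff]
  rfl

/-- Commuting with framings makes the braid part pure, since permutations act faithfully; commuting
with braids makes the framing invariant. The centre of `P_n` then suffices, and that of `B_n` is not
needed separately. -/
theorem mem_center_iff (hn : 2 ≤ n) {x : FramedBraidGroup n} :
    x ∈ Subgroup.center (FramedBraidGroup n) ↔
      x.left ∈ diagonalSubgroup n ∧ x.right ∈ Subgroup.zpowers (halfTwist n ^ 2) := by
  rw [Subgroup.mem_center_iff]
  constructor
  · intro hx
    have h1 : ∀ h, act n x.right h = h := by
      intro h
      have := congrArg SemidirectProduct.left (hx (inl h))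
      simp only [mul_left, left_inl, right_inl, map_one, MulAut.one_apply] at this
      rw [mul_comm h] at this
      exact (mul_left_cancel this).symm
    have h2 : ∀ g, act n g x.left = x.left := by
      intro g
      have := congrArg SemidirectProduct.left (hx (inr g))
      simpa only [mul_left, left_inr, right_inr, map_one, mul_one, one_mul] using this
    refine ⟨mem_diagonal_of_act h2, mem_zpowers_halfTwist_sq hn (mem_ker_of_act h1) fun y _ => ?_⟩
    exact (congrArg SemidirectProduct.right (hx (inr y))).symm
  · rintro ⟨h1, h2⟩ y
    refine SemidirectProduct.ext ?_ (commute_of_mem_zpowers h2 y.right).eq.symm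
    change y.left * act n y.right x.left = x.left * act n x.right y.left
    rw [act_diagonal _ h1, act_eq_of_ker (mem_zpowers_ker h2), mul_comm]

/-- Pure braids act trivially on framings, so the framing part is unconstrained and only the centre
of `P_n` matters. -/
theorem mem_map_center_pure_iff (hn : 2 ≤ n) {x : FramedBraidGroup n} :
    x ∈ (Subgroup.center (pure n)).map (pure n).subtype ↔
      x.right ∈ Subgroup.zpowers (halfTwist n ^ 2) := by
  constructor
  · rintro ⟨⟨x, hx⟩, hc, rfl⟩
    refine mem_zpowers_halfTwist_sq hn (mem_pure_iff.1 hx) fun y hy => ?_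
    have := Subgroup.mem_center_iff.1 hc ⟨inr y, mem_pure_iff.2 hy⟩
    exact (congrArg (fun z : pure n => (z : FramedBraidGroup n).right) this).symm
  · intro h
    refine ⟨⟨x, mem_pure_iff.2 (mem_zpowers_ker h)⟩, Subgroup.mem_center_iff.2 ?_, rfl⟩
    rintro ⟨y, hy⟩
    refine Subtype.ext (SemidirectProduct.ext ?_ (commute_of_mem_zpowers h y.right).eq.symm)
    change y.left * act n y.right x.left = x.left * act n x.right y.left
    rw [act_eq_of_ker (mem_pure_iff.1 hy), act_eq_of_ker (mem_zpowers_ker h), mul_comm]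

theorem theta_eq (n : ℕ) : theta n = framing n fun _ => Multiplicative.ofAdd 1 := by
  have : List.ofFn (t (n := n)) =
      (List.ofFn fun i : Fin n => Pi.mulSingle i (Multiplicative.ofAdd (1 : ℤ))).map (framing n) := by
    rw [List.map_ofFn]; rfl
  rw [theta, this, ← map_list_prod, List.prod_ofFn,
    Finset.univ_prod_mulSingle fun _ => Multiplicative.ofAdd (1 : ℤ)]

theorem mem_zpowers_theta_iff {x : FramedBraidGroup n} :
    x ∈ Subgroup.zpowers (theta n) ↔ x.left ∈ diagonalSubgroup n ∧ x.right = 1 := by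
  rw [theta_eq, Subgroup.mem_zpowers_iff]
  constructor
  · rintro ⟨k, rfl⟩
    rw [← map_zpow]
    exact ⟨⟨Multiplicative.ofAdd 1 ^ k, rfl⟩, rfl⟩
  · rintro ⟨⟨a, ha⟩, hr⟩
    refine ⟨a.toAdd, ?_⟩
    rw [← map_zpow]
    refine SemidirectProduct.ext ?_ hr.symm
    rw [← ha]
    refine funext fun i => Multiplicative.toAdd.injective ?_
    change (Multiplicative.ofAdd (1 : ℤ) ^ a.toAdd).toAdd = a.toAdd
    simp

theorem mem_range_framing_iff {x : FramedBraidGroup n} :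
    x ∈ (framing n).range ↔ x.right = 1 :=
  ⟨fun ⟨_, h⟩ => h ▸ rfl, fun h => ⟨x.left, SemidirectProduct.ext rfl h.symm⟩⟩

theorem mem_zpowers_ofBraid_iff {x : FramedBraidGroup n} {g : BraidGroup n} :
    x ∈ Subgroup.zpowers (ofBraid n g) ↔ x.left = 1 ∧ x.right ∈ Subgroup.zpowers g := by
  rw [Subgroup.mem_zpowers_iff]
  constructor
  · rintro ⟨k, rfl⟩
    rw [← map_zpow]
    exact ⟨rfl, k, rfl⟩
  · rintro ⟨h, k, hk⟩
    refine ⟨k, ?_⟩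
    rw [← map_zpow]
    exact SemidirectProduct.ext h.symm hk

theorem isInternalDirectProduct_center_pure (hn : 2 ≤ n) :
    IsInternalDirectProduct ((Subgroup.center (pure n)).map (pure n).subtype)
      (framing n).range (Subgroup.zpowers (ofBraid n (halfTwist n ^ 2))) where
  sup_eq := by
    refine le_antisymm (sup_le ?_ ?_) ?_
    · intro x hx
      rw [mem_map_center_pure_iff hn, mem_range_framing_iff.1 hx]
      exact one_mem _
    · intro x hx
      exact (mem_map_center_pure_iff hn).2 (mem_zpowers_ofBraid_iff.1 hx).2
    · intro x hx
      have h := (mem_map_center_pure_iff hn).1 hx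
      rw [← inl_left_mul_inr_right x]
      exact Subgroup.mul_mem_sup ⟨_, rfl⟩ (mem_zpowers_ofBraid_iff.2 ⟨rfl, h⟩)
  disjoint := Subgroup.disjoint_def.2 fun {x} h1 h2 =>
    SemidirectProduct.ext (mem_zpowers_ofBraid_iff.1 h2).1 (mem_range_framing_iff.1 h1)
  commute a ha b hb := by
    obtain ⟨h1, h2⟩ := mem_zpowers_ofBraid_iff.1 hb
    refine SemidirectProduct.ext ?_ (commute_of_mem_zpowers h2 a.right).eq.symm
    change a.left * act n a.right b.left = b.left * act n b.right a.left
    rw [h1, map_one, act_eq_of_ker (mem_zpowers_ker h2), mul_comm]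

theorem isInternalDirectProduct_center (hn : 2 ≤ n) :
    IsInternalDirectProduct (Subgroup.center (FramedBraidGroup n))
      (Subgroup.zpowers (theta n)) (Subgroup.zpowers (ofBraid n (halfTwist n ^ 2))) where
  sup_eq := by
    refine le_antisymm (sup_le ?_ ?_) ?_
    · intro x hx
      obtain ⟨h1, h2⟩ := mem_zpowers_theta_iff.1 hx
      exact (mem_center_iff hn).2 ⟨h1, h2 ▸ one_mem _⟩
    · intro x hx
      obtain ⟨h1, h2⟩ := mem_zpowers_ofBraid_iff.1 hx
      exact (mem_center_iff hn).2 ⟨h1 ▸ one_mem _, h2⟩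
    · intro x hx
      obtain ⟨h1, h2⟩ := (mem_center_iff hn).1 hx
      rw [← inl_left_mul_inr_right x]
      exact Subgroup.mul_mem_sup (mem_zpowers_theta_iff.2 ⟨h1, rfl⟩)
        (mem_zpowers_ofBraid_iff.2 ⟨rfl, h2⟩)
  disjoint := Subgroup.disjoint_def.2 fun {x} h1 h2 =>
    SemidirectProduct.ext (mem_zpowers_ofBraid_iff.1 h2).1 (mem_zpowers_theta_iff.1 h1).2
  commute a ha b hb := by
    obtain ⟨h1, h2⟩ := mem_zpowers_theta_iff.1 ha
    have : a ∈ Subgroup.center (FramedBraidGroup n) :=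
      (mem_center_iff hn).2 ⟨h1, h2 ▸ one_mem _⟩
    exact (Subgroup.mem_center_iff.1 this b).symm

theorem nonempty_zpowers_halfTwist_equiv (hn : 2 ≤ n) :
    Nonempty (Subgroup.zpowers (ofBraid n (halfTwist n ^ 2)) ≃* Multiplicative ℤ) := by
  refine nonempty_zpowers_equiv fun a b h => zpow_halfTwist_sq_injective hn ?_
  simp only [← map_zpow] at h
  exact inr_injective h

theorem nonempty_center_pure_equiv (hn : 2 ≤ n) :
    Nonempty (Subgroup.center (pure n) ≃* Multiplicative (Fin (n + 1) → ℤ)) := by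
  obtain ⟨e⟩ := (isInternalDirectProduct_center_pure hn).nonempty_prod_equiv
  obtain ⟨e'⟩ := nonempty_zpowers_halfTwist_equiv hn
  have e1 : (framing n).range ≃* (Fin n → Multiplicative ℤ) :=
    (MonoidHom.ofInjective (f := framing n) inl_injective).symm
  exact ⟨((Subgroup.center (pure n)).equivMapOfInjective _ (pure n).subtype_injective).trans
    (e.symm.trans ((e1.prodCongr e').trans (finSuccPiMulEquiv n).symm))⟩

theorem nonempty_center_equiv (hn : 2 ≤ n) :
    Nonempty (Subgroup.center (FramedBraidGroup n) ≃* Multiplicative (ℤ × ℤ)) := by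
  obtain ⟨e⟩ := (isInternalDirectProduct_center hn).nonempty_prod_equiv
  obtain ⟨e'⟩ := nonempty_zpowers_halfTwist_equiv hn
  obtain ⟨e1⟩ : Nonempty (Subgroup.zpowers (theta n) ≃* Multiplicative ℤ) := by
    refine nonempty_zpowers_equiv fun a b h => ?_
    simp only [theta_eq, ← map_zpow] at h
    have := congrArg Multiplicative.toAdd (congrFun (inl_injective h) ⟨0, by omega⟩)
    simpa using this
  exact ⟨e.symm.trans ((e1.prodCongr e').trans (MulEquiv.prodMultiplicative ℤ ℤ).symm)⟩

end FramedBraidGroup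

/-! ### The abelianization -/

namespace FramedBraidGroup

open BraidGroup SemidirectProduct StrandGroup

/-- The sum of the framings, with the exponent sum of the underlying braid. -/
def abHom (n : ℕ) : FramedBraidGroup n →* Multiplicative ℤ × Multiplicative ℤ :=
  SemidirectProduct.lift
    (MonoidHom.prod
      { toFun := fun h => ∏ i, h i
        map_one' := by simp
        map_mul' := fun _ _ => Finset.prod_mul_distrib } 1)
    (MonoidHom.prod 1 (expSum n))
    (by
      intro g
      refine MonoidHom.ext fun h => ?_
      rw [MonoidHom.comp_apply, MonoidHom.comp_apply, MonoidHom.comp_apply,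
        MulEquiv.coe_toMonoidHom, MulEquiv.coe_toMonoidHom, MulAut.conj_apply, mul_inv_cancel_comm]
      refine Prod.ext ?_ rfl
      exact Equiv.prod_comp (toPerm n g)⁻¹ h)

theorem abHom_t {n : ℕ} (i : Fin n) : abHom n (t i) = (Multiplicative.ofAdd 1, 1) := by
  rw [t, framing, abHom, lift_inl]
  exact Prod.ext (by simp) rfl

theorem abHom_gen {n i : ℕ} (hi : i + 1 < n) :
    abHom n (ofBraid n (natGen n i)) = (1, Multiplicative.ofAdd 1) := by
  rw [ofBraid, abHom, lift_inr]
  exact Prod.ext rfl (expSum_natGen hi)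

theorem conj_t {n : ℕ} (g : BraidGroup n) (i : Fin n) :
    ofBraid n g * t i * (ofBraid n g)⁻¹ = t (toPerm n g i) := by
  rw [ofBraid, t, t, framing, ← map_inv, ← inl_aut]
  congr 1
  funext j
  change (Pi.mulSingle i _ : Fin n → Multiplicative ℤ) ((toPerm n g)⁻¹ j) = _
  simp only [Pi.mulSingle_apply, Equiv.Perm.inv_eq_iff_eq]

theorem abelianization_t {n : ℕ} (i j : Fin n) :
    Abelianization.of (t i) = Abelianization.of (t j) := by
  rcases n with - | n
  · exact i.elim0
  have key : ∀ i : Fin (n + 1), Abelianization.of (t i) = Abelianization.of (t (0 : Fin (n + 1))) := by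
    intro i
    induction i using Fin.induction with
    | zero => rfl
    | succ i ih =>
      have h := conj_t (natGen (n + 1) i) i.castSucc
      rw [toPerm_natGen (by omega)] at h
      have h' : Equiv.swap (⟨i, by omega⟩ : Fin (n + 1)) ⟨i + 1, by omega⟩ i.castSucc = i.succ :=
        Equiv.swap_apply_left i.castSucc i.succ
      rw [h'] at h
      rw [← ih, ← h, map_mul, map_mul, map_inv, mul_inv_cancel_comm]
  rw [key i, key j]

theorem abelianization_gen {n i : ℕ} (hi : i + 1 < n) :
    Abelianization.of (ofBraid n (natGen n i)) = Abelianization.of (ofBraid n (natGen n 0)) := by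
  induction i with
  | zero => rfl
  | succ i ih =>
    rw [← ih (by omega)]
    have h := congrArg (fun x => Abelianization.of (ofBraid n x))
      ((isBraidSeq_natGen n).braid i hi)
    simp only [map_mul] at h
    rw [mul_comm (Abelianization.of (ofBraid n (natGen n (i + 1))))] at h
    exact (mul_left_cancel h).symm

/-- All `t_i` are conjugate, and the braid relation identifies consecutive `σ_i` after abelianizing,
so two classes generate; `abHom` sends them to the standard basis of `ℤ × ℤ`. -/
theorem nonempty_abelianization_equiv {n : ℕ} (hn : 2 ≤ n) :
    Nonempty (Abelianization (FramedBraidGroup n) ≃* Multiplicative (ℤ × ℤ)) := by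
  let i0 : Fin n := ⟨0, by omega⟩
  let ψ : Multiplicative ℤ × Multiplicative ℤ →* Abelianization (FramedBraidGroup n) :=
    (zpowersHom _ (Abelianization.of (t i0))).coprod
      (zpowersHom _ (Abelianization.of (ofBraid n (natGen n 0))))
  have h1 : ψ.comp (Abelianization.lift (abHom n)) = MonoidHom.id _ := by
    refine Abelianization.hom_ext _ _ (SemidirectProduct.hom_ext ?_ ?_)
    · refine MonoidHom.functions_ext' _ _ _ fun i => MonoidHom.ext_mint ?_
      change ψ (abHom n (t i)) = Abelianization.of (t i)
      rw [abHom_t, abelianization_t i i0]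
      simp [ψ]
    · refine BraidGroup.hom_ext fun i hi => ?_
      change ψ (abHom n (ofBraid n (natGen n i))) = Abelianization.of (ofBraid n (natGen n i))
      rw [abHom_gen hi, abelianization_gen hi]
      simp [ψ]
  have h2 : (Abelianization.lift (abHom n)).comp ψ = MonoidHom.id _ := by
    refine MonoidHom.ext fun ⟨a, b⟩ => ?_
    simp only [ψ, MonoidHom.comp_apply, MonoidHom.coprod_apply, map_mul, zpowersHom_apply, map_zpow,
      Abelianization.lift_apply_of, abHom_t, abHom_gen (show 0 + 1 < n by omega), MonoidHom.id_apply]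
    ext <;> simp
  exact ⟨(MonoidHom.toMulEquiv _ _ h1 h2).trans (MulEquiv.prodMultiplicative ℤ ℤ).symm⟩

/-! ### The quotient of `FB_3` by its centre -/

/-- The action of braids on framings modulo the diagonal. -/
def quotAct (n : ℕ) :
    BraidGroup n →* MulAut ((Fin n → Multiplicative ℤ) ⧸ diagonalSubgroup n) where
  toFun g := QuotientGroup.congr _ _ (act n g) (by
    ext h
    constructor
    · rintro ⟨h, hh, rfl⟩
      exact (act_diagonal g hh).symm ▸ hh
    · exact fun hh => ⟨h, hh, act_diagonal g hh⟩)
  map_one' := by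
    refine MulEquiv.ext fun x => ?_
    induction x using QuotientGroup.induction_on with
    | H h => rfl
  map_mul' g g' := by
    refine MulEquiv.ext fun x => ?_
    induction x using QuotientGroup.induction_on with
    | H h => exact congrArg QuotientGroup.mk (by rw [map_mul]; rfl)

theorem quotAct_mk {n : ℕ} (g : BraidGroup n) (h : Fin n → Multiplicative ℤ) :
    quotAct n g (QuotientGroup.mk h) = QuotientGroup.mk (act n g h) := rfl

/-- The isomorphism `ℤ^3 / ℤ(1,1,1) ≅ ℤ^2`. -/
noncomputable def quotDiagonalEquiv :
    ((Fin 3 → Multiplicative ℤ) ⧸ diagonalSubgroup 3) ≃* Multiplicative (ℤ × ℤ) :=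
  let f : (Fin 3 → Multiplicative ℤ) →* Multiplicative (ℤ × ℤ) :=
    { toFun := fun h => Multiplicative.ofAdd
        ((h 0).toAdd - (h 2).toAdd, (h 1).toAdd - (h 2).toAdd)
      map_one' := by simp
      map_mul' := fun h k => by
        rw [← ofAdd_add]
        congr 1
        ext <;> simp <;> ring }
  have hf : diagonalSubgroup 3 = f.ker := by
    ext h
    rw [MonoidHom.mem_ker]
    constructor
    · rintro ⟨a, rfl⟩
      exact congrArg Multiplicative.ofAdd (Prod.ext (sub_self _) (sub_self _))
    · intro hh
      have hh' := Prod.ext_iff.1 (congrArg Multiplicative.toAdd hh)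
      refine ⟨h 2, funext fun i => Multiplicative.toAdd.injective ?_⟩
      have h0 : (h 0).toAdd - (h 2).toAdd = 0 := hh'.1
      have h1 : (h 1).toAdd - (h 2).toAdd = 0 := hh'.2
      change (h 2).toAdd = (h i).toAdd
      fin_cases i
      · exact (sub_eq_zero.1 h0).symm
      · exact (sub_eq_zero.1 h1).symm
      · rfl
  have hs : Function.Surjective f := fun x =>
    ⟨![Multiplicative.ofAdd x.toAdd.1, Multiplicative.ofAdd x.toAdd.2, 1], by
      apply Multiplicative.toAdd.injective
      simp [f]⟩
  (QuotientGroup.quotientMulEquivOfEq hf).trans (QuotientGroup.quotientKerEquivOfSurjective f hs)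

end FramedBraidGroup

namespace BraidGroup

/-- The isomorphism `B_3 / Z(B_3) ≅ PSL_2(ℤ)`. -/
noncomputable def quotCenterEquiv : (BraidGroup 3 ⧸ Subgroup.center (BraidGroup 3)) ≃*
    Matrix.ProjectiveSpecialLinearGroup (Fin 2) ℤ :=
  let f : BraidGroup 3 →* Matrix.ProjectiveSpecialLinearGroup (Fin 2) ℤ :=
    (QuotientGroup.mk' (Subgroup.center _)).comp toSL
  have hf : Subgroup.center (BraidGroup 3) = f.ker := by
    ext x
    rw [center_three, ← mem_center_iff_toSL, MonoidHom.mem_ker]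
    exact (QuotientGroup.eq_one_iff _).symm
  have hs : Function.Surjective f := (QuotientGroup.mk'_surjective _).comp toSL_surjective
  (QuotientGroup.quotientMulEquivOfEq hf).trans (QuotientGroup.quotientKerEquivOfSurjective f hs)

end BraidGroup

namespace FramedBraidGroup

open BraidGroup SemidirectProduct StrandGroup

/-- The centre of `FB_3` is the diagonal times the centre of `B_3`, so quotienting both factors of
the semidirect product has exactly this kernel. The action passes to `PSL_2(ℤ)` because the centre
of `B_3` consists of pure braids. -/
theorem exists_quotient_center_three_equiv :
    ∃ (d : ((Fin 3 → Multiplicative ℤ) ⧸ diagonalSubgroup 3) ≃* Multiplicative (ℤ × ℤ))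
        (e : (BraidGroup 3 ⧸ Subgroup.center (BraidGroup 3)) ≃*
          Matrix.ProjectiveSpecialLinearGroup (Fin 2) ℤ)
        (φ : Matrix.ProjectiveSpecialLinearGroup (Fin 2) ℤ →* MulAut (Multiplicative (ℤ × ℤ)))
        (Ψ : (FramedBraidGroup 3 ⧸ Subgroup.center (FramedBraidGroup 3)) ≃*
          (Multiplicative (ℤ × ℤ)) ⋊[φ] (Matrix.ProjectiveSpecialLinearGroup (Fin 2) ℤ)),
      ∀ x : FramedBraidGroup 3,
        Ψ (QuotientGroup.mk x) =
          ⟨d (QuotientGroup.mk x.left), e (QuotientGroup.mk x.right)⟩ := by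
  let d := quotDiagonalEquiv
  let e := quotCenterEquiv
  let α : BraidGroup 3 →* MulAut (Multiplicative (ℤ × ℤ)) :=
    (MulAut.congr d).toMonoidHom.comp (quotAct 3)
  have hα : ∀ g ∈ Subgroup.center (BraidGroup 3), α g = 1 := by
    intro g hg
    rw [center_three] at hg
    have : quotAct 3 g = 1 := by
      refine MulEquiv.ext fun x => ?_
      induction x using QuotientGroup.induction_on with
      | H h => rw [quotAct_mk, act_eq_of_ker (mem_zpowers_ker hg)]; rfl
    change MulAut.congr d (quotAct 3 g) = 1
    rw [this, map_one]
  let φ : Matrix.ProjectiveSpecialLinearGroup (Fin 2) ℤ →* MulAut (Multiplicative (ℤ × ℤ)) :=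
    (QuotientGroup.lift _ α hα).comp e.symm.toMonoidHom
  have hφ : ∀ g h, φ (e (QuotientGroup.mk g)) (d (QuotientGroup.mk h)) =
      d (QuotientGroup.mk (act 3 g h)) := by
    intro g h
    have h1 : φ (e (QuotientGroup.mk g)) = α g := by
      change QuotientGroup.lift _ α hα (e.symm (e (QuotientGroup.mk g))) = α g
      rw [MulEquiv.symm_apply_apply]
      rfl
    rw [h1]
    change d (quotAct 3 g (d.symm (d (QuotientGroup.mk h)))) = _
    rw [MulEquiv.symm_apply_apply, quotAct_mk]
  let Θ : FramedBraidGroup 3 →*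
      (Multiplicative (ℤ × ℤ)) ⋊[φ] (Matrix.ProjectiveSpecialLinearGroup (Fin 2) ℤ) :=
    SemidirectProduct.map (d.toMonoidHom.comp (QuotientGroup.mk' _))
      (e.toMonoidHom.comp (QuotientGroup.mk' _))
      fun g => MonoidHom.ext fun h => (hφ g h).symm
  have hΘ : ∀ x : FramedBraidGroup 3,
      Θ x = ⟨d (QuotientGroup.mk x.left), e (QuotientGroup.mk x.right)⟩ := fun _ => rfl
  have hs : Function.Surjective Θ := by
    rintro ⟨u, v⟩
    obtain ⟨h, hh⟩ := QuotientGroup.mk_surjective (d.symm u)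
    obtain ⟨g, hg⟩ := QuotientGroup.mk_surjective (e.symm v)
    refine ⟨⟨h, g⟩, ?_⟩
    rw [hΘ, hh, hg, MulEquiv.apply_symm_apply, MulEquiv.apply_symm_apply]
  have hk : Subgroup.center (FramedBraidGroup 3) = Θ.ker := by
    ext x
    rw [mem_center_iff (by omega), ← center_three, MonoidHom.mem_ker, hΘ, SemidirectProduct.ext_iff,
      one_left, one_right, map_eq_one_iff d d.injective, map_eq_one_iff e e.injective,
      QuotientGroup.eq_one_iff, QuotientGroup.eq_one_iff]
  exact ⟨d, e, φ, (QuotientGroup.quotientMulEquivOfEq hk).trans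
    (QuotientGroup.quotientKerEquivOfSurjective Θ hs), fun x => hΘ x⟩

end FramedBraidGroup


theorem mainTheorem12 (n : ℕ) (hn : 3 ≤ n) :
    -- the centre of `FP_n`, seen inside `FB_n`
    (IsInternalDirectProduct
        ((Subgroup.center (FramedBraidGroup.pure n)).map (FramedBraidGroup.pure n).subtype)
        (FramedBraidGroup.framing n).range
        (Subgroup.zpowers (FramedBraidGroup.ofBraid n (BraidGroup.halfTwist n ^ 2))) ∧
      Nonempty (Subgroup.center (FramedBraidGroup.pure n) ≃*
        Multiplicative (Fin (n + 1) → ℤ))) ∧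
    -- the centre of `FB_n`
    (IsInternalDirectProduct
        (Subgroup.center (FramedBraidGroup n))
        (Subgroup.zpowers (FramedBraidGroup.theta n))
        (Subgroup.zpowers (FramedBraidGroup.ofBraid n (BraidGroup.halfTwist n ^ 2))) ∧
      Nonempty (Subgroup.center (FramedBraidGroup n) ≃* Multiplicative (ℤ × ℤ))) ∧
    -- `FB_3 / Z(FB_3)`, with `PSL_2(ℤ) ≅ B_3 / Z(B_3)` acting on `ℤ^2 ≅ ℤ^3 / diagonal`
    -- by the action induced from the one of `B_3` on `ℤ^3`
    (∃ (d : ((Fin 3 → Multiplicative ℤ) ⧸ diagonalSubgroup 3) ≃* Multiplicative (ℤ × ℤ))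
        (e : (BraidGroup 3 ⧸ Subgroup.center (BraidGroup 3)) ≃*
          Matrix.ProjectiveSpecialLinearGroup (Fin 2) ℤ)
        (φ : Matrix.ProjectiveSpecialLinearGroup (Fin 2) ℤ →* MulAut (Multiplicative (ℤ × ℤ)))
        (Ψ : (FramedBraidGroup 3 ⧸ Subgroup.center (FramedBraidGroup 3)) ≃*
          (Multiplicative (ℤ × ℤ)) ⋊[φ] (Matrix.ProjectiveSpecialLinearGroup (Fin 2) ℤ)),
      ∀ x : FramedBraidGroup 3,
        Ψ (QuotientGroup.mk x) =
          ⟨d (QuotientGroup.mk x.left), e (QuotientGroup.mk x.right)⟩) ∧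
    -- the abelianization of `FB_n`
    Nonempty (Abelianization (FramedBraidGroup n) ≃* Multiplicative (ℤ × ℤ)) := by
  have hn' : 2 ≤ n := by omega
  exact ⟨⟨FramedBraidGroup.isInternalDirectProduct_center_pure hn',
      FramedBraidGroup.nonempty_center_pure_equiv hn'⟩,
    ⟨FramedBraidGroup.isInternalDirectProduct_center hn',
      FramedBraidGroup.nonempty_center_equiv hn'⟩,
    FramedBraidGroup.exists_quotient_center_three_equiv,
    FramedBraidGroup.nonempty_abelianization_equiv hn'⟩
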